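/- **Setting.** Let $D\subset\mathbb R^d$, $d\in\{2,3\}$, be a bounded Lipschitz domain with volume $|D|$. Let $\Gamma_{in},\Gamma_{out}\subset\partial D$ be disjoint measurable sets, put $\Gamma_{wall}=\partial D\setminus(\Gamma_{in}\cup\Gamma_{out})$, and let $g$ be a boundary velocity on $\Gamma_{in}$. Fix constants $\alpha_0\ge 0$, $\epsilon,\eta,\Delta t>0$, $\beta\in[0,1]$, $\tilde S\ge \eta/(4\epsilon)$, $\beta_0\ge0$ and integers $N\ge 0$, $K\ge1$. Put $\alpha(s)=\alpha_0(1-s)^2$, $F(s)=\tfrac14s^2(s-1)^2$, $f(s)=F'(s)=s(1-s)(\tfrac12-s)$, $J_v(\phi)=\int_D\phi\,dx-\beta|D|$, and $$L(\phi,u,\lambda)=\int_D\tfrac12|\nabla u|^2+\tfrac12\alpha(\phi)|u|^2\,dx+\eta\int_D\tfrac{\epsilon}{2}|\nabla\phi|^2+\tfrac1\epsilon F(\phi)\,dx+\lambda J_v(\phi).$$ A velocity $u$ is called admissible if $u\in H^1(D)^d$, $\nabla\cdot u=0$ in $D$, and $u=g$ on $\Gamma_{in}$, $u=0$ on $\Gamma_{wall}$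 in the sense of traces. **Scheme.** Let $\phi^0$ be measurable with $0\le\phi^0\le1$ a.e. in $D$, and let $\lambda^0\in\mathbb R$. For $n=0,\dots,N-1$: 1. $(u^{n+1},p^{n+1})$, with $u^{n+1}$ admissible and $p^{n+1}\in L^2(D)$, is a weak solution of the penalized Stokes problem $-\Delta u+\nabla p+\alpha(\phi^n)u=0$, $\nabla\cdot u=0$ with the natural condition on $\Gamma_{out}$, that is, $\int_D\nabla u^{n+1}:\nabla w-p^{n+1}\,\nabla\cdot w+\alpha(\phi^n)u^{n+1}\cdot w\,dx=0$ for all $w\in H^1(D)^d$ with zero trace on $\Gamma_{in}\cup\Gamma_{wall}$. 2. Set $\phi^{n+1,0}=\phi^n$, $\lambda^{n+1,0}=\lambda^n$. For $k=0,\dots,K-1$: (a) $\phi^{n+1,k+1,*}\in H^1(D)$ is a weak solution, with homogeneous Neumann boundary condition, of $$\frac{\phi^{n+1,k+1,*}}{\Delta t}-\epsilon\eta\Delta\phi^{n+1,k+1,*}+\frac{\alpha_0|u^{n+1}|^2}{2}\phi^{n+1,k+1,*}+\tilde S\phi^{n+1,k+1,*}=\frac{\phi^{n+1,k}}{\Delta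 t}-\frac\eta\epsilon f(\phi^{n+1,k})-\alpha_0|u^{n+1}|^2\Big(\frac{\phi^{n+1,k}}2-1\Big)-\lambda^{n+1,k}+\tilde S\phi^{n+1,k};$$ (b) $\phi^{n+1,k+1}=\min(\max(\phi^{n+1,k+1,*},0),1)$ a.e. in $D$; (c) $\lambda^{n+1,k+1}=\lambda^{n+1,k}-\beta_0J_v(\phi^{n+1,k+1})$ if $J_v(\phi^{n+1,k+1,*})\ge J_v(\phi^{n+1,k+1})$, and $\lambda^{n+1,k+1}=\lambda^{n+1,k}-\beta_0^*J_v(\phi^{n+1,k+1})$ otherwise, where $\beta_0^*=\lambda^{n+1,k}\int_D(\phi^{n+1,k+1}-\phi^{n+1,k+1,*})\,dx\,/\,J_v(\phi^{n+1,k+1})^2$. 3. Set $\phi^{n+1}=\phi^{n+1,K}$, $\lambda^{n+1}=\lambda^{n+1,K}$. Assume that in every inner iteration * $J_v(\phi^{n+1,k+1})\ne0$ whenever the variable step $\beta_0^*$ is used; * the fixed step $\beta_0$ is proper: if it is used while $\lambda^{n+1,k}<0$, then $\lambda^{n+1,k}\int_D(\phi^{n+1,k+1}-\phi^{n+1,k+1,*})\,dx\le\beta_0\,J_v(\phi^{n+1,k+1})^2$.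 (For $\lambda^{n+1,k}\ge0$ nothing beyond $\beta_0\ge0$ is required.) **Theorem.** The Lagrangian never increases from one outer step to the next: $$L(\phi^{n+1},u^{n+1},\lambda^{n+1})\le L(\phi^n,u^n,\lambda^n)$$ for all $1\le n<N$, and also for $n=0<N$ if $\phi^0\in H^1(D)$ and $u^0$ is any admissible velocity. -/

import Mathlib

open MeasureTheory Filter Topology Set
open scoped ContDiff

namespace PhaseStokes

noncomputable section

/-- The ambient Euclidean space `ℝ^d`. -/
abbrev Sp (d : ℕ) : Type := EuclideanSpace ℝ (Fin d)

/-! ### Domains, Sobolev functions, traces -/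

/-- Bounded Lipschitz domain: open, connected, bounded, and near each boundary point it is, for
some unit direction `ν`, the region above the graph of a Lipschitz function of the variables
orthogonal to `ν` (a Lipschitz function on `ℝ^d` that is invariant in direction `ν`). -/
def IsLipschitzDomain {d : ℕ} (D : Set (Sp d)) : Prop :=
  IsOpen D ∧ IsConnected D ∧ Bornology.IsBounded D ∧
    ∀ x ∈ frontier D, ∃ r : ℝ, 0 < r ∧ ∃ ν : Sp d, ‖ν‖ = 1 ∧ ∃ γ : Sp d → ℝ,
      (∃ C, LipschitzWith C γ) ∧ (∀ (y : Sp d) (t : ℝ), γ (y + t • ν) = γ y) ∧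
      ∀ y ∈ Metric.ball x r, (y ∈ D ↔ γ y < inner ℝ ν y)

/-- `G` is the weak (distributional) gradient of `v` on `D`. -/
def HasWeakGradient {d : ℕ} (D : Set (Sp d)) (v : Sp d → ℝ) (G : Sp d → Sp d) : Prop :=
  LocallyIntegrableOn v D volume ∧ LocallyIntegrableOn G D volume ∧
    ∀ ψ : Sp d → ℝ, ContDiff ℝ ∞ ψ → HasCompactSupport ψ → tsupport ψ ⊆ D → ∀ i : Fin d,
      ∫ x in D, v x * (gradient ψ x) i = -∫ x in D, (G x) i * ψ x

/-- The Sobolev space `H¹(D)`. -/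
def MemH1 {d : ℕ} (D : Set (Sp d)) (v : Sp d → ℝ) : Prop :=
  MemLp v 2 (volume.restrict D) ∧
    ∃ G : Sp d → Sp d, HasWeakGradient D v G ∧ MemLp G 2 (volume.restrict D)

open Classical in
/-- The weak gradient, unique up to null sets when it exists (and `0` by convention if not). -/
def weakGrad {d : ℕ} (D : Set (Sp d)) (v : Sp d → ℝ) : Sp d → Sp d :=
  if h : ∃ G, HasWeakGradient D v G then h.choose else 0

/-- `v ∈ H¹(D)` has the boundary trace `h` on the boundary part `Γ`: some functions that are smooth
on `ℝ^d` converge to `v` in `H¹(D)` and to `h` in `L²(Γ)` for the surface measure. -/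
def HasTrace {d : ℕ} (D Γ : Set (Sp d)) (v h : Sp d → ℝ) : Prop :=
  MemLp h 2 ((Measure.hausdorffMeasure ((d : ℝ) - 1)).restrict Γ) ∧
    ∃ w : ℕ → Sp d → ℝ, (∀ j, ContDiff ℝ ∞ (w j)) ∧
      Tendsto (fun j => eLpNorm (fun x => w j x - v x) 2 (volume.restrict D)) atTop (𝓝 0) ∧
      Tendsto (fun j => eLpNorm (fun x => gradient (w j) x - weakGrad D v x) 2
        (volume.restrict D)) atTop (𝓝 0) ∧
      Tendsto (fun j => eLpNorm (fun x => w j x - h x) 2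
        ((Measure.hausdorffMeasure ((d : ℝ) - 1)).restrict Γ)) atTop (𝓝 0)

/-- `H¹(D)^d`. -/
def MemH1Vec {d : ℕ} (D : Set (Sp d)) (u : Sp d → Sp d) : Prop :=
  ∀ i : Fin d, MemH1 D (fun x => (u x) i)

/-- Componentwise trace of a vector field. -/
def HasTraceVec {d : ℕ} (D Γ : Set (Sp d)) (u h : Sp d → Sp d) : Prop :=
  ∀ i : Fin d, HasTrace D Γ (fun x => (u x) i) (fun x => (h x) i)

/-- The integrand `∇u : ∇w`. -/
def gradDot {d : ℕ} (D : Set (Sp d)) (u w : Sp d → Sp d) (x : Sp d) : ℝ :=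
  ∑ i : Fin d, inner ℝ (weakGrad D (fun y => (u y) i) x) (weakGrad D (fun y => (w y) i) x)

/-- The weak divergence `∇ · u`. -/
def weakDiv {d : ℕ} (D : Set (Sp d)) (u : Sp d → Sp d) (x : Sp d) : ℝ :=
  ∑ i : Fin d, (weakGrad D (fun y => (u y) i) x) i

/-! ### The Lagrangian -/

/-- The parameters of the model and of the scheme. -/
structure Params where
  /-- penalization constant `α₀` -/
  α₀ : ℝ
  /-- interface width `ε` -/
  ε : ℝ
  /-- perimeter weight `η` -/
  η : ℝ
  /-- volume fraction `β` -/
  β : ℝ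
  /-- time step `Δt` -/
  Δt : ℝ
  /-- stabilization parameter `S̃` -/
  S : ℝ
  /-- fixed step `β₀` of the multiplier -/
  β₀ : ℝ

/-- The penalization `α(s) = α₀ (1 - s)²`. -/
def alpha (P : Params) (s : ℝ) : ℝ := P.α₀ * (1 - s) ^ 2

/-- The double well `F(s) = s² (s - 1)² / 4`. -/
def F (s : ℝ) : ℝ := 1 / 4 * s ^ 2 * (s - 1) ^ 2

/-- Its derivative `f(s) = s (1 - s) (1/2 - s)`. -/
def f (s : ℝ) : ℝ := s * (1 - s) * (1 / 2 - s)

/-- The penalized dissipation `J_α(φ, u)`. -/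
def Jalpha {d : ℕ} (P : Params) (D : Set (Sp d)) (φ : Sp d → ℝ) (u : Sp d → Sp d) : ℝ :=
  (∫ x in D, 1 / 2 * gradDot D u u x) + ∫ x in D, 1 / 2 * alpha P (φ x) * ‖u x‖ ^ 2

/-- The Ginzburg--Landau energy `J_ε(φ)`. -/
def Jeps {d : ℕ} (P : Params) (D : Set (Sp d)) (φ : Sp d → ℝ) : ℝ :=
  ∫ x in D, (P.ε / 2 * ‖weakGrad D φ x‖ ^ 2 + 1 / P.ε * F (φ x))

/-- The volume defect `J_v(φ) = ∫_D φ - β |D|`. -/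
def Jv {d : ℕ} (P : Params) (D : Set (Sp d)) (φ : Sp d → ℝ) : ℝ :=
  (∫ x in D, φ x) - P.β * volume.real D

/-- The Lagrangian `L(φ, u, λ)`. -/
def Lagr {d : ℕ} (P : Params) (D : Set (Sp d)) (φ : Sp d → ℝ) (u : Sp d → Sp d) (lam : ℝ) : ℝ :=
  Jalpha P D φ u + P.η * Jeps P D φ + lam * Jv P D φ

/-! ### The sub-steps of the scheme -/

/-- Divergence-free velocities in `H¹(D)^d` with `u = g` on `Γin` and `u = 0` on `Γwall`. -/
structure AdmissibleVelocity {d : ℕ} (D Γin Γwall : Set (Sp d)) (g u : Sp d → Sp d) : Prop where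
  memH1 : MemH1Vec D u
  inflow : HasTraceVec D Γin u g
  wall : HasTraceVec D Γwall u (fun _ => 0)
  divFree : ∀ᵐ x ∂(volume.restrict D), weakDiv D u x = 0

/-- Weak solution `(u, p)` of `-Δu + ∇p + α(φ) u = 0`, `∇ · u = 0` in `D`, with `u = g` on `Γin`,
`u = 0` on `Γwall`, and the natural (stress-free) condition on the rest of the boundary. -/
structure IsStokesSolution {d : ℕ} (P : Params) (D Γin Γwall : Set (Sp d)) (g : Sp d → Sp d)
    (φ : Sp d → ℝ) (u : Sp d → Sp d) (p : Sp d → ℝ) : Prop where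
  velocity : AdmissibleVelocity D Γin Γwall g u
  pressure : MemLp p 2 (volume.restrict D)
  momentum : ∀ w : Sp d → Sp d, MemH1Vec D w →
    HasTraceVec D Γin w (fun _ => 0) → HasTraceVec D Γwall w (fun _ => 0) →
    (∫ x in D, gradDot D u w x) - (∫ x in D, p x * weakDiv D w x)
      + (∫ x in D, alpha P (φ x) * inner ℝ (u x) (w x)) = 0

/-- Weak solution `φs` (with homogeneous Neumann condition) of the stabilized Allen--Cahn step
`φs/Δt - εηΔφs + (α₀|u|²/2) φs + S̃ φs
  = φ/Δt - (η/ε) f(φ) - α₀|u|² (φ/2 - 1) - λ + S̃ φ`.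
Solution and test functions are taken in `{ψ ∈ H¹(D) : |u|²ψ² ∈ L¹(D)}`, the space on which every
term is an integrable function. On a bounded Lipschitz domain in dimension 2 or 3, with
`u ∈ H¹(D)^d`, this is all of `H¹(D)` by the Sobolev embedding `H¹ ⊆ L⁴`. -/
structure IsPhaseStep {d : ℕ} (P : Params) (D : Set (Sp d)) (u : Sp d → Sp d) (lam : ℝ)
    (φ φs : Sp d → ℝ) : Prop where
  memH1 : MemH1 D φs
  finite : IntegrableOn (fun x => ‖u x‖ ^ 2 * φs x ^ 2) D volume
  weak : ∀ ψ : Sp d → ℝ, MemH1 D ψ → IntegrableOn (fun x => ‖u x‖ ^ 2 * ψ x ^ 2) D volume →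
    (∫ x in D, (φs x / P.Δt * ψ x
        + P.ε * P.η * inner ℝ (weakGrad D φs x) (weakGrad D ψ x)
        + P.α₀ * ‖u x‖ ^ 2 / 2 * φs x * ψ x
        + P.S * φs x * ψ x))
      = ∫ x in D, (φ x / P.Δt - P.η / P.ε * f (φ x)
        - P.α₀ * ‖u x‖ ^ 2 * (φ x / 2 - 1) - lam + P.S * φ x) * ψ x

/-- The cut-off to `[0, 1]`. -/
def cutoff (s : ℝ) : ℝ := min (max s 0) 1

/-- The multiplier update; `φs` is the phase field before and `φ` the one after the cut-off. -/
def lamUpdate {d : ℕ} (P : Params) (D : Set (Sp d)) (lam : ℝ) (φs φ : Sp d → ℝ) : ℝ :=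
  if Jv P D φ ≤ Jv P D φs then lam - P.β₀ * Jv P D φ
  else lam - (lam * (∫ x in D, (φ x - φs x)) / Jv P D φ ^ 2) * Jv P D φ

/-! ### The algorithm -/

/-- All the quantities the algorithm produces: `phi n`, `u n`, `p n`, `lam n` are the outer iterates
`φ^n, u^n, p^n, λ^n`; `phiIn n k`, `phiStar n k`, `lamIn n k` are the inner iterates
`φ^{n,k}, φ^{n,k,*}, λ^{n,k}`. -/
structure Iterates (d : ℕ) where
  phi : ℕ → Sp d → ℝ
  u : ℕ → Sp d → Sp d
  p : ℕ → Sp d → ℝ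
  lam : ℕ → ℝ
  phiIn : ℕ → ℕ → Sp d → ℝ
  phiStar : ℕ → ℕ → Sp d → ℝ
  lamIn : ℕ → ℕ → ℝ

/-- `X` is a run of the algorithm with `N` outer loops and `K` inner iterations in each. -/
structure IsRun {d : ℕ} (P : Params) (D Γin Γwall : Set (Sp d)) (g : Sp d → Sp d) (N K : ℕ)
    (X : Iterates d) : Prop where
  init_meas : AEStronglyMeasurable (X.phi 0) (volume.restrict D)
  init_range : ∀ᵐ x ∂(volume.restrict D), X.phi 0 x ∈ Icc (0 : ℝ) 1
  stokes : ∀ n < N, IsStokesSolution P D Γin Γwall g (X.phi n) (X.u (n + 1)) (X.p (n + 1))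
  start_phi : ∀ n < N, X.phiIn (n + 1) 0 = X.phi n
  start_lam : ∀ n < N, X.lamIn (n + 1) 0 = X.lam n
  phase : ∀ n < N, ∀ k < K, IsPhaseStep P D (X.u (n + 1)) (X.lamIn (n + 1) k)
    (X.phiIn (n + 1) k) (X.phiStar (n + 1) (k + 1))
  cut : ∀ n < N, ∀ k < K, ∀ᵐ x ∂(volume.restrict D),
    X.phiIn (n + 1) (k + 1) x = cutoff (X.phiStar (n + 1) (k + 1) x)
  multiplier : ∀ n < N, ∀ k < K, X.lamIn (n + 1) (k + 1) = lamUpdate P D (X.lamIn (n + 1) k)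
    (X.phiStar (n + 1) (k + 1)) (X.phiIn (n + 1) (k + 1))
  finish_phi : ∀ n < N, X.phi (n + 1) = X.phiIn (n + 1) K
  finish_lam : ∀ n < N, X.lam (n + 1) = X.lamIn (n + 1) K

/-- The variable step of the multiplier update is well defined: its denominator `J_v(φ^{n,k})` is
nonzero whenever that step is used. -/
def VariableStepDefined {d : ℕ} (P : Params) (D : Set (Sp d)) (N K : ℕ) (X : Iterates d) : Prop :=
  ∀ n < N, ∀ k < K,
    Jv P D (X.phiStar (n + 1) (k + 1)) < Jv P D (X.phiIn (n + 1) (k + 1)) →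
    Jv P D (X.phiIn (n + 1) (k + 1)) ≠ 0

/-- The fixed step `β₀` is proper: it is nonnegative, and whenever it is used at a negative
multiplier, it is at least the variable step
`λ (∫_D φ^{n,k} - φ^{n,k,*}) / J_v(φ^{n,k})²` (written without division). -/
def FixedStepProper {d : ℕ} (P : Params) (D : Set (Sp d)) (N K : ℕ) (X : Iterates d) : Prop :=
  0 ≤ P.β₀ ∧ ∀ n < N, ∀ k < K, X.lamIn (n + 1) k < 0 →
    Jv P D (X.phiIn (n + 1) (k + 1)) ≤ Jv P D (X.phiStar (n + 1) (k + 1)) →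
    X.lamIn (n + 1) k * (∫ x in D, (X.phiIn (n + 1) (k + 1) x - X.phiStar (n + 1) (k + 1) x))
      ≤ P.β₀ * Jv P D (X.phiIn (n + 1) (k + 1)) ^ 2

end

end PhaseStokes

namespace PhaseStokes

variable {d : ℕ}

/-! ### Weak gradients -/

/-! An outer step changes the velocity first, then the pair (φ, λ), and neither change raises the
Lagrangian.

Velocity: `IsStokesSolution.Jalpha_le`. With φ fixed, the dissipation is a convex quadratic
functional and the weak Stokes equation is its stationarity condition. The difference of two
admissible velocities is a test function, and the pressure drops out because it is divergence free.

Phase: `IsPhaseStep.Lagr_le`. Testing the weak equation with φ* - φ makes its two sides cancel, so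
it suffices to bound the energy density pointwise (`phaseDensity_cutoff_le`). The gradient term is
convex and implicit, the α-term is an exact difference, and F'' ≤ 1/2 on [0,1] lets the
stabilization S̃ ≥ η/(4ε) absorb the explicit treatment of the double well (`F_cutoff_le`). The
cut-off only helps: it lowers α, preserves the quadratic bound on F and does not increase |∇φ|
(`MemH1.of_cutoff`). The last point rests on a chain rule for weak derivatives, proved by
mollification.

Multiplier: the pointwise bound leaves λ J_v(φ*), before the cut-off. The update rule is made so
that the new multiplier term does not exceed it (`lamUpdate_mul_Jv_le`). -/

theorem gradient_apply_eq_fderiv (ψ : Sp d → ℝ) (x : Sp d) (i : Fin d) :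
    (gradient ψ x) i = fderiv ℝ ψ x (EuclideanSpace.single i 1) := by
  rw [gradient, ← InnerProductSpace.toDual_symm_apply (𝕜 := ℝ), real_inner_comm,
    EuclideanSpace.inner_single_left]
  simp

theorem continuous_gradient {ψ : Sp d → ℝ} (hψ : ContDiff ℝ ∞ ψ) : Continuous (gradient ψ) :=
  (InnerProductSpace.toDual ℝ (Sp d)).symm.continuous.comp (hψ.continuous_fderiv (by simp))

theorem tsupport_gradient_apply_subset (ψ : Sp d → ℝ) (i : Fin d) :
    tsupport (fun x => (gradient ψ x) i) ⊆ tsupport ψ := by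
  simp_rw [gradient_apply_eq_fderiv]
  refine closure_minimal ?_ (isClosed_tsupport ψ)
  refine Subset.trans ?_ (support_fderiv_subset ℝ (f := ψ))
  intro x hx h
  exact hx (by simp [h])

theorem continuous_gradient_apply {ψ : Sp d → ℝ} (hψ : ContDiff ℝ ∞ ψ) (i : Fin d) :
    Continuous (fun x => (gradient ψ x) i) := by
  simp_rw [gradient_apply_eq_fderiv]
  exact (hψ.continuous_fderiv (by simp)).clm_apply continuous_const

theorem hasCompactSupport_gradient_apply {ψ : Sp d → ℝ} (hψ : HasCompactSupport ψ) (i : Fin d) :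
    HasCompactSupport (fun x => (gradient ψ x) i) :=
  hψ.of_isClosed_subset (isClosed_tsupport _) (tsupport_gradient_apply_subset ψ i)

/-- A locally integrable function times a continuous function with compact support in `D`. -/
theorem integrableOn_mul_of_tsupport_subset {D : Set (Sp d)} {v ψ : Sp d → ℝ}
    (hD : MeasurableSet D) (hv : LocallyIntegrableOn v D volume) (hψ : Continuous ψ)
    (hc : HasCompactSupport ψ) (hs : tsupport ψ ⊆ D) :
    IntegrableOn (fun x => v x * ψ x) D volume := by
  have h1 : IntegrableOn v (tsupport ψ) volume := hv.integrableOn_compact_subset hs hc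
  have h2 : IntegrableOn (fun x => v x * ψ x) (tsupport ψ) volume :=
    h1.mul_continuousOn hψ.continuousOn hc
  refine IntegrableOn.of_forall_sdiff_eq_zero h2 hD fun x hx => ?_
  rw [image_eq_zero_of_notMem_tsupport hx.2, mul_zero]

theorem LocallyIntegrableOn.apply {D : Set (Sp d)} {G : Sp d → Sp d}
    (hG : LocallyIntegrableOn G D volume) (i : Fin d) :
    LocallyIntegrableOn (fun x => G x i) D volume := by
  intro x hx
  obtain ⟨U, hU, h⟩ := hG x hx
  exact ⟨U, hU, (EuclideanSpace.proj (𝕜 := ℝ) i).integrable_comp h⟩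

/-- The fundamental lemma of the calculus of variations, applied to each component of G - G'. It
makes the choice in `weakGrad` immaterial. -/
theorem HasWeakGradient.ae_eq {D : Set (Sp d)} (hD : IsOpen D) {v : Sp d → ℝ} {G G' : Sp d → Sp d}
    (h : HasWeakGradient D v G) (h' : HasWeakGradient D v G') :
    G =ᵐ[volume.restrict D] G' := by
  have key : ∀ i : Fin d, ∀ᵐ x ∂(volume : Measure (Sp d)), x ∈ D → G x i - G' x i = 0 := by
    intro i
    refine hD.ae_eq_zero_of_integral_contDiff_smul_eq_zero
      ((LocallyIntegrableOn.apply h.2.1 i).sub (LocallyIntegrableOn.apply h'.2.1 i)) ?_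
    intro ψ hψ hc hs
    have e1 := h.2.2 ψ hψ hc hs i
    have e2 := h'.2.2 ψ hψ hc hs i
    have i1 := integrableOn_mul_of_tsupport_subset hD.measurableSet
      (LocallyIntegrableOn.apply h.2.1 i) hψ.continuous hc hs
    have i2 := integrableOn_mul_of_tsupport_subset hD.measurableSet
      (LocallyIntegrableOn.apply h'.2.1 i) hψ.continuous hc hs
    have e3 : ∫ x in D, (G x i * ψ x - G' x i * ψ x) = 0 := by
      rw [integral_sub i1 i2]; linarith
    rw [← setIntegral_eq_integral_of_forall_compl_eq_zero (s := D), ← e3]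
    · refine integral_congr_ae (Eventually.of_forall fun x => ?_)
      simp only [smul_eq_mul]; ring
    · intro x hx
      rw [image_eq_zero_of_notMem_tsupport fun hx' => hx (hs hx'), zero_smul]
  rw [EventuallyEq, ae_restrict_iff' hD.measurableSet]
  filter_upwards [ae_all_iff.2 key] with x hx hxD
  ext i
  linarith [hx i hxD]

theorem HasWeakGradient.sub {D : Set (Sp d)} (hD : IsOpen D) {v w : Sp d → ℝ} {G H : Sp d → Sp d}
    (hv : HasWeakGradient D v G) (hw : HasWeakGradient D w H) :
    HasWeakGradient D (fun x => v x - w x) (fun x => G x - H x) := by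
  refine ⟨hv.1.sub hw.1, hv.2.1.sub hw.2.1, fun ψ hψ hc hs i => ?_⟩
  have hm := hD.measurableSet
  have a1 := integrableOn_mul_of_tsupport_subset hm hv.1 (continuous_gradient_apply hψ i)
    (hasCompactSupport_gradient_apply hc i) ((tsupport_gradient_apply_subset ψ i).trans hs)
  have a2 := integrableOn_mul_of_tsupport_subset hm hw.1 (continuous_gradient_apply hψ i)
    (hasCompactSupport_gradient_apply hc i) ((tsupport_gradient_apply_subset ψ i).trans hs)
  have b1 := integrableOn_mul_of_tsupport_subset hm (LocallyIntegrableOn.apply hv.2.1 i)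
    hψ.continuous hc hs
  have b2 := integrableOn_mul_of_tsupport_subset hm (LocallyIntegrableOn.apply hw.2.1 i)
    hψ.continuous hc hs
  simp only [sub_mul, PiLp.sub_apply]
  rw [integral_sub a1 a2, integral_sub b1 b2, hv.2.2 ψ hψ hc hs i, hw.2.2 ψ hψ hc hs i]
  ring

theorem HasWeakGradient.weakGrad {D : Set (Sp d)} {v : Sp d → ℝ} {G : Sp d → Sp d}
    (h : HasWeakGradient D v G) : HasWeakGradient D v (weakGrad D v) := by
  have hex : ∃ G, HasWeakGradient D v G := ⟨G, h⟩
  rw [PhaseStokes.weakGrad, dif_pos hex]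
  exact hex.choose_spec

theorem HasWeakGradient.weakGrad_ae_eq {D : Set (Sp d)} (hD : IsOpen D) {v : Sp d → ℝ}
    {G : Sp d → Sp d} (h : HasWeakGradient D v G) :
    PhaseStokes.weakGrad D v =ᵐ[volume.restrict D] G :=
  h.weakGrad.ae_eq hD h

theorem MemH1.hasWeakGradient {D : Set (Sp d)} {v : Sp d → ℝ} (h : MemH1 D v) :
    HasWeakGradient D v (weakGrad D v) :=
  h.2.choose_spec.1.weakGrad

theorem MemH1.memLp_weakGrad {D : Set (Sp d)} (hD : IsOpen D) {v : Sp d → ℝ} (h : MemH1 D v) :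
    MemLp (weakGrad D v) 2 (volume.restrict D) := by
  obtain ⟨G, hG, hG2⟩ := h.2
  exact hG2.ae_eq (hG.weakGrad_ae_eq hD).symm

theorem MemH1.sub {D : Set (Sp d)} (hD : IsOpen D) {v w : Sp d → ℝ} (hv : MemH1 D v)
    (hw : MemH1 D w) : MemH1 D (fun x => v x - w x) :=
  ⟨hv.1.sub hw.1, _, hv.hasWeakGradient.sub hD hw.hasWeakGradient,
    (hv.memLp_weakGrad hD).sub (hw.memLp_weakGrad hD)⟩

theorem MemH1.weakGrad_sub {D : Set (Sp d)} (hD : IsOpen D) {v w : Sp d → ℝ} (hv : MemH1 D v)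
    (hw : MemH1 D w) : weakGrad D (fun x => v x - w x) =ᵐ[volume.restrict D]
      fun x => weakGrad D v x - weakGrad D w x :=
  (hv.hasWeakGradient.sub hD hw.hasWeakGradient).weakGrad_ae_eq hD

/-- Needed because the scheme prescribes the truncated phase field only almost everywhere. -/
theorem HasWeakGradient.congr_left {D : Set (Sp d)} {v w : Sp d → ℝ} {G : Sp d → Sp d}
    (h : HasWeakGradient D v G) (hvw : v =ᵐ[volume.restrict D] w)
    (hw : LocallyIntegrableOn w D volume) :
    HasWeakGradient D w G := by
  refine ⟨hw, h.2.1, fun ψ hψ hc hs i => ?_⟩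
  rw [← h.2.2 ψ hψ hc hs i]
  refine integral_congr_ae ?_
  filter_upwards [hvw] with x hx
  rw [hx]

/-! ### Mollification -/

/-- Almost everywhere convergence without gain of mass in the limit is convergence in `L¹`. -/
theorem tendsto_integral_norm_sub_of_integral_norm_le {α : Type*} [MeasurableSpace α]
    {μ : Measure α} {u : ℕ → α → ℝ} {v : α → ℝ} (hu : ∀ n, Integrable (u n) μ)
    (hv : Integrable v μ) (hle : ∀ n, ∫ x, ‖u n x‖ ∂μ ≤ ∫ x, ‖v x‖ ∂μ)
    (hlim : ∀ᵐ x ∂μ, Tendsto (fun n => u n x) atTop (𝓝 (v x))) :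
    Tendsto (fun n => ∫ x, ‖u n x - v x‖ ∂μ) atTop (𝓝 0) := by
  -- This combination lies between 0 and 2‖v‖, so dominated convergence applies although the u n
  -- have no common majorant. The mass hypothesis then removes the two extra terms.
  have h1 : Tendsto (fun n => ∫ x, (‖u n x - v x‖ - ‖u n x‖ + ‖v x‖) ∂μ) atTop
      (𝓝 (∫ _, (0 : ℝ) ∂μ)) := by
    refine tendsto_integral_of_dominated_convergence (fun x => 2 * ‖v x‖) ?_
      (hv.norm.const_mul 2) ?_ ?_
    · intro n
      exact ((((hu n).sub hv).norm.sub (hu n).norm).add hv.norm).aestronglyMeasurable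
    · intro n
      refine Eventually.of_forall fun x => ?_
      rw [Real.norm_eq_abs, abs_le]
      have a1 := norm_sub_le (u n x) (v x)
      have a2 := norm_sub_norm_le (u n x) (v x)
      constructor <;> linarith [norm_nonneg (v x)]
    · filter_upwards [hlim] with x hx
      have : Tendsto (fun n => ‖u n x - v x‖ - ‖u n x‖ + ‖v x‖) atTop
          (𝓝 (‖v x - v x‖ - ‖v x‖ + ‖v x‖)) :=
        (((hx.sub tendsto_const_nhds).norm).sub hx.norm).add tendsto_const_nhds
      simpa using this
  rw [integral_zero] at h1
  refine squeeze_zero (fun n => integral_nonneg fun x => norm_nonneg _) (fun n => ?_) h1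
  have : ∫ x, (‖u n x - v x‖ - ‖u n x‖ + ‖v x‖) ∂μ
      = ∫ x, ‖u n x - v x‖ ∂μ - ∫ x, ‖u n x‖ ∂μ + ∫ x, ‖v x‖ ∂μ := by
    have k1 : Integrable (fun x => ‖u n x - v x‖) μ := ((hu n).sub hv).norm
    have k2 : Integrable (fun x => ‖u n x - v x‖ - ‖u n x‖) μ := k1.sub (hu n).norm
    rw [integral_add k2 hv.norm, integral_sub k1 (hu n).norm]
  rw [this]
  linarith [hle n]

open scoped Convolution
open ContinuousLinearMap (lsmul)

/-- The kernel is nonnegative with mass one: the convolution is dominated by that of |v|, whose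
integral is that of |v|. -/
theorem integral_norm_convolution_normed_le (φ : ContDiffBump (0 : Sp d)) {v : Sp d → ℝ}
    (hv : Integrable v volume) :
    ∫ x, ‖(φ.normed volume ⋆[lsmul ℝ ℝ, volume] v) x‖ ≤ ∫ x, ‖v x‖ := by
  have hφ : Integrable (φ.normed (volume : Measure (Sp d))) volume := φ.integrable_normed
  have h : ∫ x, (φ.normed volume ⋆[lsmul ℝ ℝ, volume] fun y => ‖v y‖) x = ∫ x, ‖v x‖ := by
    rw [integral_convolution _ hφ hv.norm, φ.integral_normed]
    simp
  rw [← h]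
  refine integral_mono (hφ.integrable_convolution _ hv).norm
    (hφ.integrable_convolution _ hv.norm) fun x => ?_
  refine (norm_integral_le_integral_norm _).trans (le_of_eq ?_)
  refine integral_congr_ae (Eventually.of_forall fun t => ?_)
  simp [norm_mul, abs_of_nonneg (φ.nonneg_normed t)]

theorem tendsto_integral_norm_convolution_sub {φ : ℕ → ContDiffBump (0 : Sp d)} {C : ℝ}
    (hφ : Tendsto (fun n => (φ n).rOut) atTop (𝓝 0)) (hC : ∀ n, (φ n).rOut ≤ C * (φ n).rIn)
    {v : Sp d → ℝ} (hv : Integrable v volume) :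
    Tendsto (fun n => ∫ x, ‖((φ n).normed volume ⋆[lsmul ℝ ℝ, volume] v) x - v x‖)
      atTop (𝓝 0) :=
  tendsto_integral_norm_sub_of_integral_norm_le
    (fun n => (φ n).integrable_normed.integrable_convolution _ hv) hv
    (fun n => integral_norm_convolution_normed_le (φ n) hv)
    (ContDiffBump.ae_convolution_tendsto_right_of_locallyIntegrable hφ
      (Eventually.of_forall hC) hv.locallyIntegrable)

/-- Away from the boundary, mollification commutes with weak differentiation. -/
theorem HasWeakGradient.fderiv_convolution {D : Set (Sp d)} (hD : IsOpen D) {v : Sp d → ℝ}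
    {G : Sp d → Sp d} (h : HasWeakGradient D v G) (hv : IntegrableOn v D volume)
    (φ : ContDiffBump (0 : Sp d)) {x : Sp d} (hx : Metric.closedBall x φ.rOut ⊆ D) (i : Fin d) :
    fderiv ℝ (φ.normed volume ⋆[lsmul ℝ ℝ, volume] D.indicator v) x (EuclideanSpace.single i 1)
      = (φ.normed volume ⋆[lsmul ℝ ℝ, volume] D.indicator fun y => G y i) x := by
  set ρ : Sp d → ℝ := φ.normed volume with hρ
  set e : Sp d := EuclideanSpace.single i 1
  have hρs : ContDiff ℝ ∞ ρ := φ.contDiff_normed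
  have hρ1 : ContDiff ℝ 1 ρ := φ.contDiff_normed
  have hρc : HasCompactSupport ρ := φ.hasCompactSupport_normed
  have hV : LocallyIntegrable (D.indicator v) volume :=
    ((integrable_indicator_iff hD.measurableSet).2 hv).locallyIntegrable
  have hd := (hρc.hasFDerivAt_convolution_left (lsmul ℝ ℝ) hρ1 hV x).fderiv
  have hex := (hρc.fderiv (𝕜 := ℝ)).convolutionExists_left
    ((lsmul ℝ ℝ).precompL (Sp d)) (hρ1.continuous_fderiv one_ne_zero) hV x
  -- the translated and reflected mollifier is a test function on `D`
  have hψd : ∀ y, HasFDerivAt (fun y => ρ (x - y)) (-(fderiv ℝ ρ (x - y))) y := by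
    intro y
    have h1 := (hρ1.differentiable one_ne_zero (x - y)).hasFDerivAt
    have h2 : HasFDerivAt (fun y : Sp d => x - y) (-(ContinuousLinearMap.id ℝ (Sp d))) y :=
      (hasFDerivAt_id y).const_sub x
    exact (h1.comp y h2).congr_fderiv (by ext z; simp)
  have hψs : ContDiff ℝ ∞ (fun y => ρ (x - y)) := hρs.comp (contDiff_const.sub contDiff_id)
  have hψsub : tsupport (fun y => ρ (x - y)) ⊆ Metric.closedBall x φ.rOut := by
    refine closure_minimal (fun y hy => ?_) Metric.isClosed_closedBall
    have : x - y ∈ Metric.ball (0 : Sp d) φ.rOut := by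
      rw [← φ.support_normed_eq (μ := volume)]; exact hy
    rw [Metric.mem_closedBall, dist_eq_norm, norm_sub_rev]
    exact (mem_ball_zero_iff.1 this).le
  have hψc : HasCompactSupport (fun y => ρ (x - y)) :=
    (isCompact_closedBall x φ.rOut).of_isClosed_subset (isClosed_tsupport _) hψsub
  have hw := h.2.2 _ hψs hψc (hψsub.trans hx) i
  have e1 : fderiv ℝ (ρ ⋆[lsmul ℝ ℝ, volume] D.indicator v) x e
      = ∫ y, fderiv ℝ ρ (x - y) e * D.indicator v y := by
    rw [hd, convolution_def, ContinuousLinearMap.integral_apply hex]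
    rw [← integral_sub_left_eq_self _ volume x]
    refine integral_congr_ae (Eventually.of_forall fun y => ?_)
    simp [ContinuousLinearMap.precompL_apply, smul_eq_mul]
  -- The reflection y ↦ x - y turns the derivative of the mollifier into minus that of the test
  -- function, which brings in the weak gradient.
  have e2 : ∫ y, fderiv ℝ ρ (x - y) e * D.indicator v y
      = -∫ y in D, v y * (gradient (fun y => ρ (x - y)) y) i := by
    rw [← integral_neg, ← integral_indicator hD.measurableSet]
    refine integral_congr_ae (Eventually.of_forall fun y => ?_)
    by_cases hy : y ∈ D
    · simp only [indicator_of_mem hy, gradient_apply_eq_fderiv, (hψd y).fderiv]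
      simp only [neg_apply, mul_neg, neg_neg]
      exact mul_comm _ _
    · simp only [indicator_of_notMem hy, mul_zero]
  rw [e1, e2, hw, neg_neg, convolution_eq_swap, ← integral_indicator hD.measurableSet]
  refine integral_congr_ae (Eventually.of_forall fun y => ?_)
  by_cases hy : y ∈ D
  · simp only [indicator_of_mem hy, ContinuousLinearMap.lsmul_apply, smul_eq_mul]
    exact mul_comm _ _
  · simp only [indicator_of_notMem hy, ContinuousLinearMap.lsmul_apply, smul_zero]

/-- A sequence of bump functions that concentrates at the origin. -/
theorem exists_contDiffBump_seq : ∃ φ : ℕ → ContDiffBump (0 : Sp d),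
    Tendsto (fun n => (φ n).rOut) atTop (𝓝 0) ∧ ∀ n, (φ n).rOut ≤ 2 * (φ n).rIn := by
  refine ⟨fun n => ⟨1 / ((n : ℝ) + 1), 2 * (1 / ((n : ℝ) + 1)), by positivity, ?_⟩, ?_, ?_⟩
  · have : (0 : ℝ) < 1 / ((n : ℝ) + 1) := by positivity
    linarith
  · simpa using (tendsto_one_div_add_atTop_nhds_zero_nat (𝕜 := ℝ)).const_mul 2
  · intro n
    exact le_rfl

/-! ### Chain rule and dominated limits for weak gradients -/

theorem integrableOn_of_bounded_comp {D : Set (Sp d)} (hfin : volume D ≠ ⊤) {v : Sp d → ℝ}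
    (hv : AEStronglyMeasurable v (volume.restrict D)) {h : ℝ → ℝ} (hh : Continuous h) {C : ℝ}
    (hC : ∀ s, |h s| ≤ C) : IntegrableOn (fun x => h (v x)) D volume :=
  haveI : IsFiniteMeasure (volume.restrict D) := ⟨by simpa using hfin.lt_top⟩
  Integrable.of_bound (hh.comp_aestronglyMeasurable hv) C (Eventually.of_forall fun x => hC _)

/-- The chain rule for weak derivatives. -/
theorem HasWeakGradient.comp {D : Set (Sp d)} (hD : IsOpen D) (hfin : volume D ≠ ⊤)
    {v : Sp d → ℝ} {G : Sp d → Sp d} (hvG : HasWeakGradient D v G) (hv : IntegrableOn v D volume)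
    (hG : IntegrableOn G D volume) {h h' : ℝ → ℝ} (hh : ∀ s, HasDerivAt h (h' s) s)
    (hh' : Continuous h') {C : ℝ} (hC : ∀ s, |h s| ≤ C) (hC' : ∀ s, |h' s| ≤ C) :
    HasWeakGradient D (fun x => h (v x)) (fun x => h' (v x) • G x) := by
  have hhc : Continuous h := continuous_iff_continuousAt.2 fun s => (hh s).continuousAt
  have hm := hD.measurableSet
  have hC0 : 0 ≤ C := (abs_nonneg _).trans (hC 0)
  refine ⟨(integrableOn_of_bounded_comp hfin hv.aestronglyMeasurable hhc hC).locallyIntegrableOn,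
    ?_, ?_⟩
  · refine IntegrableOn.locallyIntegrableOn ?_
    exact Integrable.bdd_smul hG C (hh'.comp_aestronglyMeasurable hv.aestronglyMeasurable)
      (Eventually.of_forall fun x => hC' _)
  intro ψ hψ hψc hψD i
  set e : Sp d := EuclideanSpace.single i 1 with he
  set V := D.indicator v with hVdef
  set W := D.indicator (fun y => G y i) with hWdef
  have hV : Integrable V volume := (integrable_indicator_iff hm).2 hv
  have hW : Integrable W volume := (integrable_indicator_iff hm).2
    ((EuclideanSpace.proj (𝕜 := ℝ) i).integrable_comp hG)
  obtain ⟨φ, hφ, hφC⟩ := exists_contDiffBump_seq (d := d)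
  set Vn : ℕ → Sp d → ℝ := fun n => (φ n).normed volume ⋆[lsmul ℝ ℝ, volume] V with hVn
  set Wn : ℕ → Sp d → ℝ := fun n => (φ n).normed volume ⋆[lsmul ℝ ℝ, volume] W with hWn
  have hVlim : ∀ᵐ x ∂(volume : Measure (Sp d)), Tendsto (fun n => Vn n x) atTop (𝓝 (V x)) :=
    ContDiffBump.ae_convolution_tendsto_right_of_locallyIntegrable hφ
      (Eventually.of_forall hφC) hV.locallyIntegrable
  have hWlim := tendsto_integral_norm_convolution_sub hφ hφC hW
  have hVs : ∀ n, ContDiff ℝ ∞ (Vn n) := fun n =>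
    (φ n).hasCompactSupport_normed.contDiff_convolution_left (lsmul ℝ ℝ)
      (φ n).contDiff_normed hV.locallyIntegrable
  have hWi : ∀ n, Integrable (Wn n) volume := fun n =>
    (φ n).integrable_normed.integrable_convolution _ hW
  have hψ'c : Continuous fun x => fderiv ℝ ψ x e :=
    (hψ.continuous_fderiv (by simp)).clm_apply continuous_const
  have hψ's : HasCompactSupport fun x => fderiv ℝ ψ x e := hψc.fderiv_apply ℝ e
  have hψ'i : Integrable (fun x => fderiv ℝ ψ x e) volume :=
    hψ'c.integrable_of_hasCompactSupport hψ's
  obtain ⟨M, hM⟩ := hψc.exists_bound_of_continuous hψ.continuous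
  -- the classical identity for the mollified function
  have hibp : ∀ᶠ n in atTop, ∫ x, h (Vn n x) * fderiv ℝ ψ x e
      = -∫ x, h' (Vn n x) * Wn n x * ψ x := by
    -- A δ-neighbourhood of the support of ψ stays inside D. Once the mollification radius is below
    -- δ, differentiation and mollification commute wherever ψ is nonzero.
    obtain ⟨δ, hδ, hδD⟩ := hψc.isCompact.exists_cthickening_subset_open hD hψD
    filter_upwards [hφ.eventually (gt_mem_nhds hδ)] with n hn
    have hd : ∀ x, HasFDerivAt (fun x => h (Vn n x)) (h' (Vn n x) • fderiv ℝ (Vn n) x) x :=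
      fun x => (hh _).comp_hasFDerivAt x (((hVs n).differentiable (by simp)) x).hasFDerivAt
    have hc1 : Continuous fun x => h (Vn n x) := hhc.comp (hVs n).continuous
    have hc2 : Continuous fun x => fderiv ℝ (fun x => h (Vn n x)) x e := by
      simp_rw [fun x => (hd x).fderiv]
      exact ((hh'.comp (hVs n).continuous).smul
        ((hVs n).continuous_fderiv (by simp))).clm_apply continuous_const
    rw [integral_mul_fderiv_eq_neg_fderiv_mul_of_integrable
      ((hc2.mul hψ.continuous).integrable_of_hasCompactSupport hψc.mul_left)
      ((hc1.mul hψ'c).integrable_of_hasCompactSupport hψ's.mul_left)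
      ((hc1.mul hψ.continuous).integrable_of_hasCompactSupport hψc.mul_left)
      (fun x _ => (hd x).differentiableAt) (fun x _ => hψ.differentiable (by simp) x)]
    congr 1
    refine integral_congr_ae (Eventually.of_forall fun x => ?_)
    by_cases hx : x ∈ tsupport ψ
    · have hxD : Metric.closedBall x (φ n).rOut ⊆ D := by
        refine Subset.trans ?_ hδD
        exact (Metric.closedBall_subset_closedBall (le_of_lt hn)).trans
          (Metric.closedBall_subset_cthickening hx δ)
      simp only [(hd x).fderiv, smul_apply, smul_eq_mul]
      congr 2
      exact hvG.fderiv_convolution hD hv (φ n) hxD i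
    · simp only [image_eq_zero_of_notMem_tsupport hx, mul_zero]
  -- passage to the limit
  have hL : Tendsto (fun n => ∫ x, h (Vn n x) * fderiv ℝ ψ x e) atTop
      (𝓝 (∫ x, h (V x) * fderiv ℝ ψ x e)) := by
    refine tendsto_integral_of_dominated_convergence (fun x => C * ‖fderiv ℝ ψ x e‖) ?_
      (hψ'i.norm.const_mul C) ?_ ?_
    · intro n
      exact ((hhc.comp (hVs n).continuous).mul hψ'c).aestronglyMeasurable
    · intro n
      refine Eventually.of_forall fun x => ?_
      rw [norm_mul]
      exact mul_le_mul_of_nonneg_right (hC _) (norm_nonneg _)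
    · filter_upwards [hVlim] with x hx
      exact ((hhc.tendsto _).comp hx).mul_const _
  have hR1 : Tendsto (fun n => ∫ x, h' (Vn n x) * W x * ψ x) atTop
      (𝓝 (∫ x, h' (V x) * W x * ψ x)) := by
    refine tendsto_integral_of_dominated_convergence (fun x => C * ‖W x‖ * M) ?_
      ((hW.norm.const_mul C).mul_const M) ?_ ?_
    · intro n
      exact ((hh'.comp (hVs n).continuous).aestronglyMeasurable.mul
        hW.aestronglyMeasurable).mul hψ.continuous.aestronglyMeasurable
    · intro n
      refine Eventually.of_forall fun x => ?_
      rw [norm_mul, norm_mul]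
      exact mul_le_mul (mul_le_mul_of_nonneg_right (hC' _) (norm_nonneg _)) (hM x)
        (norm_nonneg _) (by positivity)
    · filter_upwards [hVlim] with x hx
      exact (((hh'.tendsto _).comp hx).mul_const _).mul_const _
  have hM0 : 0 ≤ M := (norm_nonneg _).trans (hM 0)
  have hint : ∀ n (Z : Sp d → ℝ), Integrable Z volume →
      Integrable (fun x => h' (Vn n x) * Z x * ψ x) volume := fun n Z hZ =>
    (hZ.bdd_mul (hh'.comp (hVs n).continuous).aestronglyMeasurable
      (Eventually.of_forall fun x => hC' _)).mul_bdd (c := M) hψ.continuous.aestronglyMeasurable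
      (Eventually.of_forall hM)
  -- Two limits are separated: Wn is replaced by W through L¹ convergence, since h' and ψ are
  -- bounded. Afterwards only Vn varies, and it converges almost everywhere.
  have hR2 : Tendsto (fun n => (∫ x, h' (Vn n x) * Wn n x * ψ x)
      - ∫ x, h' (Vn n x) * W x * ψ x) atTop (𝓝 0) := by
    refine squeeze_zero_norm (fun n => ?_) (by simpa using hWlim.const_mul (C * M))
    rw [← integral_sub (hint n _ (hWi n)) (hint n _ hW), ← integral_const_mul]
    refine norm_integral_le_of_norm_le (((hWi n).sub hW).norm.const_mul (C * M))
      (Eventually.of_forall fun x => ?_)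
    have : h' (Vn n x) * Wn n x * ψ x - h' (Vn n x) * W x * ψ x
        = h' (Vn n x) * ψ x * (Wn n x - W x) := by ring
    rw [this, norm_mul, norm_mul]
    exact mul_le_mul_of_nonneg_right (mul_le_mul (hC' _) (hM x) (norm_nonneg _) hC0)
      (norm_nonneg _)
  have hR : Tendsto (fun n => -∫ x, h' (Vn n x) * Wn n x * ψ x) atTop
      (𝓝 (-∫ x, h' (V x) * W x * ψ x)) := by
    have := (hR2.add hR1).neg
    simpa using this
  have hfinal := tendsto_nhds_unique_of_eventuallyEq hL hR hibp
  have t1 : ∫ x in D, h (v x) * (gradient ψ x) i = ∫ x, h (V x) * fderiv ℝ ψ x e := by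
    rw [← integral_indicator hm]
    refine integral_congr_ae (Eventually.of_forall fun x => ?_)
    by_cases hx : x ∈ D
    · simp only [hVdef, indicator_of_mem hx, gradient_apply_eq_fderiv, he]
    · have : (gradient ψ x) i = 0 := image_eq_zero_of_notMem_tsupport
        (f := fun x => (gradient ψ x) i)
        fun hx' => hx (hψD (tsupport_gradient_apply_subset ψ i hx'))
      simp only [indicator_of_notMem hx]
      rw [he, ← gradient_apply_eq_fderiv, this, mul_zero]
  have t2 : ∫ x in D, (h' (v x) • G x) i * ψ x = ∫ x, h' (V x) * W x * ψ x := by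
    rw [← integral_indicator hm]
    refine integral_congr_ae (Eventually.of_forall fun x => ?_)
    by_cases hx : x ∈ D
    · simp only [hVdef, hWdef, indicator_of_mem hx, PiLp.smul_apply, smul_eq_mul]
    · simp only [hWdef, indicator_of_notMem hx, mul_zero, zero_mul]
  rw [t1, t2, hfinal]

/-- Dominated limits of weakly differentiable functions. -/
theorem HasWeakGradient.of_tendsto {D : Set (Sp d)} {v : ℕ → Sp d → ℝ}
    {w b B : Sp d → ℝ} {G : ℕ → Sp d → Sp d} {H : Sp d → Sp d}
    (h : ∀ n, HasWeakGradient D (v n) (G n)) (hvm : ∀ n, IntegrableOn (v n) D volume)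
    (hGm : ∀ n, IntegrableOn (G n) D volume) (hb : IntegrableOn b D volume)
    (hB : IntegrableOn B D volume) (hvb : ∀ n x, ‖v n x‖ ≤ b x) (hGB : ∀ n x, ‖G n x‖ ≤ B x)
    (hv : ∀ x, Tendsto (fun n => v n x) atTop (𝓝 (w x)))
    (hG : ∀ x, Tendsto (fun n => G n x) atTop (𝓝 (H x))) : HasWeakGradient D w H := by
  have hw : IntegrableOn w D volume := hb.mono'
    (aestronglyMeasurable_of_tendsto_ae atTop (fun n => (hvm n).aestronglyMeasurable)
      (Eventually.of_forall hv))
    (Eventually.of_forall fun x => le_of_tendsto (hv x).norm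
      (Eventually.of_forall fun n => hvb n x))
  have hH : IntegrableOn H D volume := hB.mono'
    (aestronglyMeasurable_of_tendsto_ae atTop (fun n => (hGm n).aestronglyMeasurable)
      (Eventually.of_forall hG))
    (Eventually.of_forall fun x => le_of_tendsto (hG x).norm
      (Eventually.of_forall fun n => hGB n x))
  refine ⟨hw.locallyIntegrableOn, hH.locallyIntegrableOn, fun ψ hψ hc hs i => ?_⟩
  obtain ⟨M, hM⟩ := hc.exists_bound_of_continuous hψ.continuous
  have hgc := continuous_gradient_apply hψ i
  obtain ⟨M', hM'⟩ := (hasCompactSupport_gradient_apply hc i).exists_bound_of_continuous hgc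
  have l1 : Tendsto (fun n => ∫ x in D, v n x * (gradient ψ x) i) atTop
      (𝓝 (∫ x in D, w x * (gradient ψ x) i)) := by
    refine tendsto_integral_of_dominated_convergence (fun x => b x * M') (fun n => ?_)
      (hb.mul_const M') (fun n => Eventually.of_forall fun x => ?_)
      (Eventually.of_forall fun x => (hv x).mul_const _)
    · exact (hvm n).aestronglyMeasurable.mul hgc.aestronglyMeasurable
    · rw [norm_mul]
      exact mul_le_mul (hvb n x) (hM' x) (norm_nonneg _) ((norm_nonneg _).trans (hvb n x))
  have l2 : Tendsto (fun n => -∫ x in D, (G n x) i * ψ x) atTop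
      (𝓝 (-∫ x in D, (H x) i * ψ x)) := by
    refine (tendsto_integral_of_dominated_convergence (fun x => B x * M) (fun n => ?_)
      (hB.mul_const M) (fun n => Eventually.of_forall fun x => ?_)
      (Eventually.of_forall fun x => ?_)).neg
    · exact ((EuclideanSpace.proj (𝕜 := ℝ) i).continuous.comp_aestronglyMeasurable
        (hGm n).aestronglyMeasurable).mul hψ.continuous.aestronglyMeasurable
    · rw [norm_mul]
      exact mul_le_mul ((PiLp.norm_apply_le _ i).trans (hGB n x)) (hM x) (norm_nonneg _)
        ((norm_nonneg _).trans (hGB n x))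
    · exact ((EuclideanSpace.proj (𝕜 := ℝ) i).continuous.tendsto _ |>.comp (hG x)).mul_const _
  refine tendsto_nhds_unique l1 (l2.congr fun n => ?_)
  rw [(h n).2.2 ψ hψ hc hs i]

/-! ### The cut-off -/

theorem continuous_cutoff : Continuous cutoff :=
  (continuous_id.max continuous_const).min continuous_const

theorem cutoff_mem_Icc (s : ℝ) : cutoff s ∈ Icc (0 : ℝ) 1 :=
  ⟨le_min (le_max_right _ _) zero_le_one, min_le_right _ _⟩

/-- Continuous approximations of the indicator of `(0, 1)`. -/
def cutoffSlope (m : ℕ) (t : ℝ) : ℝ := min 1 (m * max 0 (min t (1 - t)))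

theorem continuous_cutoffSlope (m : ℕ) : Continuous (cutoffSlope m) := by
  unfold cutoffSlope
  fun_prop

theorem cutoffSlope_nonneg (m : ℕ) (t : ℝ) : 0 ≤ cutoffSlope m t :=
  le_min zero_le_one (mul_nonneg m.cast_nonneg (le_max_left _ _))

theorem cutoffSlope_le_one (m : ℕ) (t : ℝ) : cutoffSlope m t ≤ 1 := min_le_left _ _

theorem cutoffSlope_of_notMem (m : ℕ) {t : ℝ} (ht : t ∉ Ioo (0 : ℝ) 1) : cutoffSlope m t = 0 := by
  have : min t (1 - t) ≤ 0 := by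
    by_contra h
    rw [not_le, lt_min_iff] at h
    exact ht ⟨h.1, by linarith [h.2]⟩
  simp [cutoffSlope, max_eq_left this]

theorem tendsto_cutoffSlope (t : ℝ) :
    Tendsto (fun m => cutoffSlope m t) atTop (𝓝 ((Ioo (0 : ℝ) 1).indicator 1 t)) := by
  by_cases ht : t ∈ Ioo (0 : ℝ) 1
  · rw [indicator_of_mem ht, Pi.one_apply]
    have hpos : 0 < min t (1 - t) := lt_min ht.1 (by linarith [ht.2])
    refine tendsto_const_nhds.congr' ?_
    have := (tendsto_natCast_atTop_atTop (R := ℝ)).atTop_mul_const hpos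
    filter_upwards [this.eventually_ge_atTop 1] with m hm
    rw [cutoffSlope, max_eq_right hpos.le, min_eq_left hm]
  · rw [indicator_of_notMem ht]
    simp_rw [cutoffSlope_of_notMem _ ht]
    exact tendsto_const_nhds

/-- Continuously differentiable approximations of the cut-off. -/
noncomputable def smoothCutoff (m : ℕ) (s : ℝ) : ℝ := ∫ t in (0 : ℝ)..s, cutoffSlope m t

theorem hasDerivAt_smoothCutoff (m : ℕ) (s : ℝ) :
    HasDerivAt (smoothCutoff m) (cutoffSlope m s) s :=
  intervalIntegral.integral_hasDerivAt_right ((continuous_cutoffSlope m).intervalIntegrable _ _)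
    ((continuous_cutoffSlope m).stronglyMeasurableAtFilter _ _)
    (continuous_cutoffSlope m).continuousAt

/-- The slope vanishes outside (0,1), so the primitive is constant there. In this form the bound by
1 and the limit in m are immediate. -/
theorem smoothCutoff_eq (m : ℕ) (s : ℝ) :
    smoothCutoff m s = ∫ t in (0 : ℝ)..cutoff s, cutoffSlope m t := by
  have hi := fun a b => (continuous_cutoffSlope m).intervalIntegrable (μ := volume) a b
  rw [smoothCutoff, ← intervalIntegral.integral_add_adjacent_intervals (hi 0 (cutoff s)) (hi _ s),
    add_eq_left]
  rcases le_total s 0 with hs | hs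
  · have hc : cutoff s = 0 := by rw [cutoff, max_eq_right hs, min_eq_left zero_le_one]
    rw [hc]
    refine (intervalIntegral.integral_congr fun t ht => ?_).trans intervalIntegral.integral_zero
    rw [uIcc_of_ge hs] at ht
    exact cutoffSlope_of_notMem m fun h => absurd ht.2 (not_le.2 h.1)
  rcases le_total s 1 with h1 | h1
  · have hc : cutoff s = s := by rw [cutoff, max_eq_left hs, min_eq_left h1]
    rw [hc, intervalIntegral.integral_same]
  · have hc : cutoff s = 1 := by rw [cutoff, max_eq_left hs, min_eq_right h1]
    rw [hc]
    refine (intervalIntegral.integral_congr fun t ht => ?_).trans intervalIntegral.integral_zero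
    rw [uIcc_of_le h1] at ht
    exact cutoffSlope_of_notMem m fun h => absurd ht.1 (not_le.2 h.2)

theorem abs_smoothCutoff_le (m : ℕ) (s : ℝ) : |smoothCutoff m s| ≤ 1 := by
  rw [smoothCutoff_eq, ← Real.norm_eq_abs]
  refine (intervalIntegral.norm_integral_le_of_norm_le_const (C := 1) fun t _ => ?_).trans ?_
  · rw [Real.norm_eq_abs, abs_of_nonneg (cutoffSlope_nonneg m t)]
    exact cutoffSlope_le_one m t
  · rw [one_mul, sub_zero, abs_of_nonneg (cutoff_mem_Icc s).1]
    exact (cutoff_mem_Icc s).2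

theorem tendsto_smoothCutoff (s : ℝ) :
    Tendsto (fun m => smoothCutoff m s) atTop (𝓝 (cutoff s)) := by
  have h : ∫ t in (0 : ℝ)..cutoff s, (Ioo (0 : ℝ) 1).indicator 1 t = cutoff s := by
    rw [intervalIntegral.integral_of_le (cutoff_mem_Icc s).1, integral_Ioc_eq_integral_Ioo,
      setIntegral_congr_fun (g := fun _ => (1 : ℝ)) measurableSet_Ioo fun t ht =>
        indicator_of_mem (Ioo_subset_Ioo_right (cutoff_mem_Icc s).2 ht) _]
    simp [(cutoff_mem_Icc s).1]
  rw [← h]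
  simp_rw [smoothCutoff_eq]
  refine intervalIntegral.tendsto_integral_filter_of_dominated_convergence (fun _ => 1)
    (Eventually.of_forall fun m => (continuous_cutoffSlope m).aestronglyMeasurable)
    (Eventually.of_forall fun m => Eventually.of_forall fun t _ => ?_)
    intervalIntegrable_const (Eventually.of_forall fun t _ => tendsto_cutoffSlope t)
  rw [Real.norm_eq_abs, abs_of_nonneg (cutoffSlope_nonneg m t)]
  exact cutoffSlope_le_one m t

/-- The weak gradient of the truncation of a weakly differentiable function. -/
theorem HasWeakGradient.cutoff {D : Set (Sp d)} (hD : IsOpen D) (hfin : volume D ≠ ⊤)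
    {v : Sp d → ℝ} {G : Sp d → Sp d} (h : HasWeakGradient D v G) (hv : IntegrableOn v D volume)
    (hG : IntegrableOn G D volume) :
    HasWeakGradient D (fun x => cutoff (v x))
      (fun x => (Ioo (0 : ℝ) 1).indicator (1 : ℝ → ℝ) (v x) • G x) := by
  have hs : ∀ m s, |cutoffSlope m s| ≤ 1 := fun m s => by
    rw [abs_of_nonneg (cutoffSlope_nonneg m s)]; exact cutoffSlope_le_one m s
  -- The approximate slopes vanish at 0 and 1 too, so they converge everywhere to the indicator of
  -- the open interval. Nothing has to be known about G on the level sets v = 0 and v = 1.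
  refine HasWeakGradient.of_tendsto (b := fun _ => 1) (B := fun x => ‖G x‖)
    (fun m => h.comp hD hfin hv hG (hasDerivAt_smoothCutoff m) (continuous_cutoffSlope m)
      (abs_smoothCutoff_le m) (hs m)) (fun m => ?_) (fun m => ?_)
    (integrableOn_const hfin) hG.norm (fun m x => abs_smoothCutoff_le m _) (fun m x => ?_)
    (fun x => tendsto_smoothCutoff _) (fun x => (tendsto_cutoffSlope _).smul_const _)
  · exact integrableOn_of_bounded_comp hfin hv.aestronglyMeasurable
      (continuous_iff_continuousAt.2 fun s => (hasDerivAt_smoothCutoff m s).continuousAt)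
      (abs_smoothCutoff_le m)
  · exact Integrable.bdd_smul hG 1
      ((continuous_cutoffSlope m).comp_aestronglyMeasurable hv.aestronglyMeasurable)
      (Eventually.of_forall fun x => hs m _)
  · rw [norm_smul]
    exact mul_le_of_le_one_left (norm_nonneg _) (hs m _)

/-- Truncation maps `H¹` into itself and does not increase the gradient. -/
theorem MemH1.of_cutoff {D : Set (Sp d)} (hD : IsOpen D) (hfin : volume D ≠ ⊤) {v w : Sp d → ℝ}
    (hv : MemH1 D v) (hw : ∀ᵐ x ∂volume.restrict D, w x = cutoff (v x)) :
    MemH1 D w ∧ ∀ᵐ x ∂volume.restrict D, ‖weakGrad D w x‖ ≤ ‖weakGrad D v x‖ := by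
  have : IsFiniteMeasure (volume.restrict D) := ⟨by simpa using hfin.lt_top⟩
  have hvi : IntegrableOn v D volume := hv.1.integrable one_le_two
  have hGi : IntegrableOn (weakGrad D v) D volume :=
    (hv.memLp_weakGrad hD).integrable one_le_two
  have h := hv.hasWeakGradient.cutoff hD hfin hvi hGi
  have hle : ∀ x, ‖(Ioo (0 : ℝ) 1).indicator (1 : ℝ → ℝ) (v x) • weakGrad D v x‖
      ≤ ‖weakGrad D v x‖ := by
    intro x
    by_cases hx : v x ∈ Ioo (0 : ℝ) 1
    · simp [indicator_of_mem hx]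
    · simp [indicator_of_notMem hx]
  have hcm : AEStronglyMeasurable (fun x => PhaseStokes.cutoff (v x)) (volume.restrict D) :=
    continuous_cutoff.comp_aestronglyMeasurable hv.1.aestronglyMeasurable
  have hw2 : MemLp w 2 (volume.restrict D) := by
    refine MemLp.ae_eq (EventuallyEq.symm hw)
      (MemLp.of_bound hcm 1 (Eventually.of_forall fun x => ?_))
    rw [Real.norm_eq_abs, abs_of_nonneg (cutoff_mem_Icc _).1]
    exact (cutoff_mem_Icc _).2
  have hwG := h.congr_left (EventuallyEq.symm hw)
    (IntegrableOn.locallyIntegrableOn (hw2.integrable one_le_two))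
  have hm : AEStronglyMeasurable
      (fun x => (Ioo (0 : ℝ) 1).indicator (1 : ℝ → ℝ) (v x) • weakGrad D v x)
      (volume.restrict D) :=
    AEStronglyMeasurable.smul
      (f := fun x => (Ioo (0 : ℝ) 1).indicator (1 : ℝ → ℝ) (v x))
      ((measurable_one.indicator measurableSet_Ioo).comp_aemeasurable
        hv.1.aestronglyMeasurable.aemeasurable).aestronglyMeasurable hGi.aestronglyMeasurable
  refine ⟨⟨hw2, _, hwG, (hv.memLp_weakGrad hD).mono hm (Eventually.of_forall hle)⟩, ?_⟩
  filter_upwards [hwG.weakGrad_ae_eq hD] with x hx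
  rw [hx]
  exact hle x

/-! ### Traces and velocities -/

theorem tendsto_eLpNorm_sub_sub {α E : Type*} [MeasurableSpace α] [NormedAddCommGroup E]
    {μ : Measure α} {a b : ℕ → α → E} {v w : α → E}
    (ha : ∀ n, AEStronglyMeasurable (a n) μ) (hb : ∀ n, AEStronglyMeasurable (b n) μ)
    (hv : AEStronglyMeasurable v μ) (hw : AEStronglyMeasurable w μ)
    (hav : Tendsto (fun n => eLpNorm (fun x => a n x - v x) 2 μ) atTop (𝓝 0))
    (hbw : Tendsto (fun n => eLpNorm (fun x => b n x - w x) 2 μ) atTop (𝓝 0)) :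
    Tendsto (fun n => eLpNorm (fun x => (a n x - b n x) - (v x - w x)) 2 μ) atTop (𝓝 0) := by
  refine tendsto_of_tendsto_of_tendsto_of_le_of_le tendsto_const_nhds
    (by simpa using hav.add hbw) (fun n => zero_le) (fun n => ?_)
  refine le_trans (le_of_eq ?_)
    (eLpNorm_sub_le ((ha n).sub hv) ((hb n).sub hw) one_le_two)
  congr 1
  ext x
  simp only [Pi.sub_apply]
  abel

theorem gradient_sub_eq {a b : Sp d → ℝ} (ha : ContDiff ℝ ∞ a) (hb : ContDiff ℝ ∞ b) (x : Sp d) :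
    gradient (fun x => a x - b x) x = gradient a x - gradient b x := by
  simp only [gradient]
  rw [fderiv_fun_sub (ha.differentiable (by simp) x) (hb.differentiable (by simp) x), map_sub]

theorem HasTrace.sub {D Γ : Set (Sp d)} (hD : IsOpen D) {v v' h h' : Sp d → ℝ} (hv : MemH1 D v)
    (hv' : MemH1 D v') (t : HasTrace D Γ v h) (t' : HasTrace D Γ v' h') :
    HasTrace D Γ (fun x => v x - v' x) (fun x => h x - h' x) := by
  obtain ⟨hh, w, hw, l1, l2, l3⟩ := t
  obtain ⟨hh', w', hw', l1', l2', l3'⟩ := t'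
  refine ⟨hh.sub hh', fun j x => w j x - w' j x, fun j => (hw j).sub (hw' j), ?_, ?_, ?_⟩
  · exact tendsto_eLpNorm_sub_sub (fun n => (hw n).continuous.aestronglyMeasurable)
      (fun n => (hw' n).continuous.aestronglyMeasurable) hv.1.aestronglyMeasurable
      hv'.1.aestronglyMeasurable l1 l1'
  · refine (tendsto_eLpNorm_sub_sub
      (fun n => (continuous_gradient (hw n)).aestronglyMeasurable)
      (fun n => (continuous_gradient (hw' n)).aestronglyMeasurable)
      (hv.memLp_weakGrad hD).aestronglyMeasurable (hv'.memLp_weakGrad hD).aestronglyMeasurable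
      l2 l2').congr fun n => eLpNorm_congr_ae ?_
    filter_upwards [hv.weakGrad_sub hD hv'] with x hx
    rw [hx, gradient_sub_eq (hw n) (hw' n)]
  · exact tendsto_eLpNorm_sub_sub (fun n => (hw n).continuous.aestronglyMeasurable)
      (fun n => (hw' n).continuous.aestronglyMeasurable) hh.aestronglyMeasurable
      hh'.aestronglyMeasurable l3 l3'

/-- Equal boundary data cancel; this makes the difference of two admissible velocities a test
function for the Stokes problem. -/
theorem HasTraceVec.sub {D Γ : Set (Sp d)} (hD : IsOpen D) {u u' h : Sp d → Sp d}
    (hu : MemH1Vec D u) (hu' : MemH1Vec D u') (t : HasTraceVec D Γ u h)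
    (t' : HasTraceVec D Γ u' h) : HasTraceVec D Γ (fun x => u x - u' x) (fun _ => 0) := by
  intro i
  simpa using (t i).sub hD (hu i) (hu' i) (t' i)

theorem MemH1Vec.sub {D : Set (Sp d)} (hD : IsOpen D) {u u' : Sp d → Sp d}
    (hu : MemH1Vec D u) (hu' : MemH1Vec D u') : MemH1Vec D (fun x => u x - u' x) :=
  fun i => (hu i).sub hD (hu' i)

theorem MemH1Vec.memLp {D : Set (Sp d)} {u : Sp d → Sp d} (hu : MemH1Vec D u) :
    MemLp u 2 (volume.restrict D) :=
  MemLp.of_eval_piLp fun i => (hu i).1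

theorem MemH1Vec.weakGrad_sub {D : Set (Sp d)} (hD : IsOpen D) {u u' : Sp d → Sp d}
    (hu : MemH1Vec D u) (hu' : MemH1Vec D u') :
    ∀ᵐ x ∂volume.restrict D, ∀ i, weakGrad D (fun y => (u y - u' y) i) x
      = weakGrad D (fun y => (u y) i) x - weakGrad D (fun y => (u' y) i) x :=
  ae_all_iff.2 fun i => (hu i).weakGrad_sub hD (hu' i)

theorem integrable_inner_of_memLp {α E : Type*} [MeasurableSpace α] [NormedAddCommGroup E]
    [InnerProductSpace ℝ E] {μ : Measure α} {a b : α → E} (ha : MemLp a 2 μ) (hb : MemLp b 2 μ) :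
    Integrable (fun x => inner ℝ (a x) (b x)) μ := by
  refine Integrable.mono' (ha.norm.integrable_mul hb.norm)
    (ha.aestronglyMeasurable.inner hb.aestronglyMeasurable) (Eventually.of_forall fun x => ?_)
  exact norm_inner_le_norm _ _

theorem MemH1Vec.integrable_gradDot {D : Set (Sp d)} (hD : IsOpen D) {u w : Sp d → Sp d}
    (hu : MemH1Vec D u) (hw : MemH1Vec D w) : IntegrableOn (gradDot D u w) D volume :=
  integrable_finsetSum _ fun i _ =>
    integrable_inner_of_memLp ((hu i).memLp_weakGrad hD) ((hw i).memLp_weakGrad hD)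

/-- A continuous function of a phase field with values in `[0, 1]` is a bounded factor. -/
theorem integrable_comp_mul {α : Type*} [MeasurableSpace α] {μ : Measure α} {φ b : α → ℝ}
    (hm : AEStronglyMeasurable φ μ) (hr : ∀ᵐ x ∂μ, φ x ∈ Icc (0 : ℝ) 1) {q : ℝ → ℝ}
    (hq : Continuous q) (hb : Integrable b μ) : Integrable (fun x => q (φ x) * b x) μ := by
  obtain ⟨C, hC⟩ := isCompact_Icc.exists_bound_of_continuousOn (s := Icc (0 : ℝ) 1) hq.continuousOn
  refine hb.bdd_mul (c := C) (hq.comp_aestronglyMeasurable hm) ?_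
  filter_upwards [hr] with x hx
  exact hC _ hx

theorem continuous_alpha (P : Params) : Continuous (alpha P) := by
  unfold alpha
  fun_prop

theorem continuous_F : Continuous F := by
  unfold F
  fun_prop

theorem continuous_f : Continuous f := by
  unfold f
  fun_prop

theorem alpha_nonneg {P : Params} (hα : 0 ≤ P.α₀) (s : ℝ) : 0 ≤ alpha P s :=
  mul_nonneg hα (sq_nonneg _)

/-- The gap is ‖b - a‖²/2. This tangent inequality is the only convexity used, both for the velocity
and for ∇φ. -/
theorem half_norm_sq_add_inner_le {E : Type*} [NormedAddCommGroup E] [InnerProductSpace ℝ E]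
    (a b : E) : 1 / 2 * ‖a‖ ^ 2 + inner ℝ a (b - a) ≤ 1 / 2 * ‖b‖ ^ 2 := by
  have h := norm_sub_sq_real b a
  rw [inner_sub_right, real_inner_self_eq_norm_sq]
  rw [real_inner_comm] at h
  nlinarith [sq_nonneg ‖b - a‖]

/-- The Stokes velocity minimizes the penalized dissipation among admissible velocities. -/
theorem IsStokesSolution.Jalpha_le {P : Params} {D Γin Γwall : Set (Sp d)} {g : Sp d → Sp d}
    {φ : Sp d → ℝ} {u v : Sp d → Sp d} {p : Sp d → ℝ} (hD : IsOpen D) (hα : 0 ≤ P.α₀)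
    (hm : AEStronglyMeasurable φ (volume.restrict D))
    (hr : ∀ᵐ x ∂(volume.restrict D), φ x ∈ Icc (0 : ℝ) 1)
    (h : IsStokesSolution P D Γin Γwall g φ u p) (hv : AdmissibleVelocity D Γin Γwall g v) :
    Jalpha P D φ u ≤ Jalpha P D φ v := by
  have hu := h.velocity
  have hw : MemH1Vec D (fun x => v x - u x) := hv.memH1.sub hD hu.memH1
  have hgrad := hv.memH1.weakGrad_sub hD hu.memH1
  -- Both velocities are divergence free, so the pressure does no work on their difference.
  have hdiv : ∫ x in D, p x * weakDiv D (fun x => v x - u x) x = 0 := by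
    rw [← integral_zero (Sp d) ℝ (μ := volume.restrict D)]
    refine integral_congr_ae ?_
    filter_upwards [hgrad, hu.divFree, hv.divFree] with x hx h1 h2
    have : weakDiv D (fun x => v x - u x) x = weakDiv D v x - weakDiv D u x := by
      simp only [weakDiv, hx, ← Finset.sum_sub_distrib]
      rfl
    rw [this, h1, h2, sub_zero, mul_zero]
  have hmom := h.momentum _ hw (hv.inflow.sub hD hv.memH1 hu.memH1 hu.inflow)
    (hv.wall.sub hD hv.memH1 hu.memH1 hu.wall)
  rw [hdiv, sub_zero] at hmom
  have i1 := hu.memH1.integrable_gradDot hD hu.memH1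
  have i2 := hu.memH1.integrable_gradDot hD hw
  have i3 := hv.memH1.integrable_gradDot hD hv.memH1
  have n1 : Integrable (fun x => ‖u x‖ ^ 2) (volume.restrict D) :=
    hu.memH1.memLp.integrable_norm_pow two_ne_zero
  have n3 : Integrable (fun x => ‖v x‖ ^ 2) (volume.restrict D) :=
    hv.memH1.memLp.integrable_norm_pow two_ne_zero
  have n2 := integrable_inner_of_memLp hu.memH1.memLp hw.memLp
  have hα2 : Continuous fun s => 1 / 2 * alpha P s := continuous_const.mul (continuous_alpha P)
  have j1 := integrable_comp_mul hm hr hα2 n1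
  have j2 := integrable_comp_mul hm hr (continuous_alpha P) n2
  have j3 := integrable_comp_mul hm hr hα2 n3
  -- The first-order terms in `a1` and `a2` add up to the left side of `hmom`, hence to zero.
  have a1 : (∫ x in D, 1 / 2 * gradDot D u u x) + (∫ x in D, gradDot D u (fun x => v x - u x) x)
      ≤ ∫ x in D, 1 / 2 * gradDot D v v x := by
    rw [← integral_add (i1.const_mul _) i2]
    refine integral_mono_ae ((i1.const_mul _).add i2) (i3.const_mul _) ?_
    filter_upwards [hgrad] with x hx
    simp only [gradDot, Finset.mul_sum, ← Finset.sum_add_distrib]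
    refine Finset.sum_le_sum fun i _ => ?_
    rw [hx i, real_inner_self_eq_norm_sq, real_inner_self_eq_norm_sq]
    exact half_norm_sq_add_inner_le _ _
  have a2 : (∫ x in D, 1 / 2 * alpha P (φ x) * ‖u x‖ ^ 2)
      + (∫ x in D, alpha P (φ x) * inner ℝ (u x) (v x - u x))
      ≤ ∫ x in D, 1 / 2 * alpha P (φ x) * ‖v x‖ ^ 2 := by
    rw [← integral_add j1 j2]
    refine integral_mono (j1.add j2) j3 fun x => ?_
    have := mul_le_mul_of_nonneg_left (half_norm_sq_add_inner_le (u x) (v x))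
      (alpha_nonneg hα (φ x))
    simp only
    linarith
  unfold Jalpha
  linarith

/-! ### The phase step -/

theorem cutoff_cases (s : ℝ) : (s ≤ 0 ∧ cutoff s = 0) ∨ (s ∈ Icc (0 : ℝ) 1 ∧ cutoff s = s) ∨
    (1 ≤ s ∧ cutoff s = 1) := by
  unfold cutoff
  rcases le_total s 0 with hs | hs
  · exact Or.inl ⟨hs, by rw [max_eq_right hs, min_eq_left zero_le_one]⟩
  rcases le_total s 1 with h1 | h1
  · exact Or.inr (Or.inl ⟨⟨hs, h1⟩, by rw [max_eq_left hs, min_eq_left h1]⟩)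
  · exact Or.inr (Or.inr ⟨h1, by rw [max_eq_left hs, min_eq_right h1]⟩)

/-- Projecting onto [0,1] cannot increase the distance to the point 1 of that interval. -/
theorem one_sub_cutoff_sq_le (s : ℝ) : (1 - cutoff s) ^ 2 ≤ (1 - s) ^ 2 := by
  rcases cutoff_cases s with ⟨hs, h⟩ | ⟨-, h⟩ | ⟨-, h⟩ <;> rw [h]
  · nlinarith
  · simpa using sq_nonneg (1 - s)

/-- Taylor's bound with F'' ≤ 1/2 on [0,1]. Here the remainder is factored explicitly as (s - p)²/4
times a sum of products of p, 1 - p, s, 1 - s. -/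
theorem F_le_of_mem_Icc {p s : ℝ} (hp : p ∈ Icc (0 : ℝ) 1) (hs : s ∈ Icc (0 : ℝ) 1) :
    F s ≤ F p + f p * (s - p) + 1 / 4 * (s - p) ^ 2 := by
  have hQ : 0 ≤ 3 * (p * (1 - p)) + s * (1 - s) + p * (1 - s) + s * (1 - p) := by
    have := mul_nonneg hp.1 (sub_nonneg.2 hp.2)
    have := mul_nonneg hs.1 (sub_nonneg.2 hs.2)
    have := mul_nonneg hp.1 (sub_nonneg.2 hs.2)
    have := mul_nonneg hs.1 (sub_nonneg.2 hp.2)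
    linarith
  have key : F p + f p * (s - p) + 1 / 4 * (s - p) ^ 2 - F s
      = 1 / 4 * (s - p) ^ 2 * (3 * (p * (1 - p)) + s * (1 - s) + p * (1 - s) + s * (1 - p)) := by
    unfold F f
    ring
  have := mul_nonneg (mul_nonneg (by norm_num : (0 : ℝ) ≤ 1 / 4) (sq_nonneg (s - p))) hQ
  linarith

/-- Quadratic bound for the double well: after the cut-off only its curvature on `[0, 1]`
matters. -/
theorem F_cutoff_le {p : ℝ} (hp : p ∈ Icc (0 : ℝ) 1) (s : ℝ) :
    F (cutoff s) ≤ F p + f p * (s - p) + 1 / 4 * (s - p) ^ 2 := by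
  have h0 := mul_nonneg hp.1 (sub_nonneg.2 hp.2)
  rcases cutoff_cases s with ⟨hs, h⟩ | ⟨hs, h⟩ | ⟨hs, h⟩ <;> rw [h]
  -- The quadratic bound holds at the endpoint 0. As a function of s, the parabola is larger at any
  -- s ≤ 0 than at 0, since its slope at 0 is f(p) - p/2 ≤ 0. The case s ≥ 1 is analogous, with
  -- slope (1 - p)²(p + 1/2) at 1.
  · refine (F_le_of_mem_Icc hp ⟨le_rfl, zero_le_one⟩).trans ?_
    have key : (f p * (s - p) + 1 / 4 * (s - p) ^ 2) - (f p * (0 - p) + 1 / 4 * (0 - p) ^ 2)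
        = -s * (1 / 2 * p * p * (1 - p) + p * (1 - p) * (1 / 2 * p) + p * (1 / 2 * p)
          + 1 / 4 * -s) := by
      unfold f
      ring
    have := mul_nonneg h0 hp.1
    have : 0 ≤ -s * (1 / 2 * p * p * (1 - p) + p * (1 - p) * (1 / 2 * p) + p * (1 / 2 * p)
          + 1 / 4 * -s) := by
      refine mul_nonneg (by linarith) ?_
      nlinarith [mul_nonneg hp.1 hp.1]
    linarith
  · exact F_le_of_mem_Icc hp hs
  · refine (F_le_of_mem_Icc hp ⟨zero_le_one, le_rfl⟩).trans ?_
    have key : (f p * (s - p) + 1 / 4 * (s - p) ^ 2) - (f p * (1 - p) + 1 / 4 * (1 - p) ^ 2)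
        = (s - 1) * ((1 - p) * ((1 - p) * (p + 1 / 2)) + 1 / 4 * (s - 1)) := by
      unfold f
      ring
    have : 0 ≤ (s - 1) * ((1 - p) * ((1 - p) * (p + 1 / 2)) + 1 / 4 * (s - 1)) := by
      have h1 : 0 ≤ 1 - p := sub_nonneg.2 hp.2
      have h2 : 0 ≤ p + 1 / 2 := by linarith [hp.1]
      have h3 : 0 ≤ s - 1 := by linarith
      positivity
    linarith

/-- The multiplier update does not increase the multiplier term. -/
theorem lamUpdate_mul_Jv_le {P : Params} {D : Set (Sp d)} {lam : ℝ} {φs φ : Sp d → ℝ}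
    (hφs : IntegrableOn φs D volume) (hφ : IntegrableOn φ D volume) (hβ₀ : 0 ≤ P.β₀)
    (hvar : Jv P D φs < Jv P D φ → Jv P D φ ≠ 0)
    (hfix : lam < 0 → Jv P D φ ≤ Jv P D φs →
      lam * (∫ x in D, (φ x - φs x)) ≤ P.β₀ * Jv P D φ ^ 2) :
    lamUpdate P D lam φs φ * Jv P D φ ≤ lam * Jv P D φs := by
  have hI : ∫ x in D, (φ x - φs x) = Jv P D φ - Jv P D φs := by
    rw [integral_sub hφ hφs, Jv, Jv]
    ring
  rw [hI] at hfix
  unfold lamUpdate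
  split_ifs with hc
  -- For λ ≥ 0 the branch condition already gives λ J_v(φ) ≤ λ J_v(φ*), and β₀ only subtracts a
  -- square. For λ < 0 that inequality reverses, and properness of β₀ pays for it.
  · rcases lt_or_ge lam 0 with hl | hl
    · have := hfix hl hc
      nlinarith
    · nlinarith [mul_nonneg hβ₀ (sq_nonneg (Jv P D φ)), mul_le_mul_of_nonneg_left hc hl]
  -- The variable step is the one that gives equality.
  · have h0 := hvar (not_le.1 hc)
    rw [hI]
    refine le_of_eq ?_
    field_simp
    ring

/-- The Lagrangian density without the dissipation `|∇u|²/2`, which the phase step keeps fixed;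
the multiplier term is evaluated at `s`, the others at `c`. -/
noncomputable def phaseDensity (P : Params) (U lam c q s : ℝ) : ℝ :=
  1 / 2 * alpha P c * U + P.η * (P.ε / 2 * q + 1 / P.ε * F c) + lam * s

/-- The pointwise energy inequality behind one phase step. -/
theorem phaseDensity_cutoff_le {E : Type*} [NormedAddCommGroup E] [InnerProductSpace ℝ E]
    {P : Params} (hα : 0 ≤ P.α₀) (hε : 0 < P.ε) (hη : 0 < P.η) (hΔt : 0 < P.Δt)
    (hS : P.η / (4 * P.ε) ≤ P.S) {p : ℝ} (hp : p ∈ Icc (0 : ℝ) 1) (s lam : ℝ) {U : ℝ} (hU : 0 ≤ U)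
    {a b c : E} (hc : ‖c‖ ≤ ‖b‖) :
    phaseDensity P U lam (cutoff s) (‖c‖ ^ 2) s ≤ phaseDensity P U lam p (‖a‖ ^ 2) p
      + ((s / P.Δt * (s - p) + P.ε * P.η * inner ℝ b (b - a) + P.α₀ * U / 2 * s * (s - p)
          + P.S * s * (s - p))
        - (p / P.Δt - P.η / P.ε * f p - P.α₀ * U * (p / 2 - 1) - lam + P.S * p) * (s - p)) := by
  -- Here a, b, c stand for the gradients of the old, the untruncated and the truncated field. The
  -- tangent is taken at b because the diffusion is implicit.
  have h1 : P.η * P.ε * (1 / 2 * ‖c‖ ^ 2) ≤ P.η * P.ε * (1 / 2 * ‖a‖ ^ 2 + inner ℝ b (b - a)) := by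
    refine mul_le_mul_of_nonneg_left ?_ (mul_pos hη hε).le
    have e1 := half_norm_sq_add_inner_le b a
    have e2 : inner ℝ b (a - b) = -inner ℝ b (b - a) := by rw [← inner_neg_right, neg_sub]
    have e3 : ‖c‖ ^ 2 ≤ ‖b‖ ^ 2 := pow_le_pow_left₀ (norm_nonneg _) hc 2
    linarith
  have h2 : P.η / P.ε * F (cutoff s)
      ≤ P.η / P.ε * (F p + f p * (s - p) + 1 / 4 * (s - p) ^ 2) :=
    mul_le_mul_of_nonneg_left (F_cutoff_le hp s) (div_pos hη hε).le
  have h3 : P.α₀ * U * (1 - cutoff s) ^ 2 ≤ P.α₀ * U * (1 - s) ^ 2 :=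
    mul_le_mul_of_nonneg_left (one_sub_cutoff_sq_le s) (mul_nonneg hα hU)
  have h4 : P.η / (4 * P.ε) * (s - p) ^ 2 ≤ P.S * (s - p) ^ 2 :=
    mul_le_mul_of_nonneg_right hS (sq_nonneg _)
  have h5 : 0 ≤ 1 / P.Δt * (s - p) ^ 2 := by positivity
  have e4 : P.η / (4 * P.ε) = P.η / P.ε * (1 / 4) := by field_simp
  rw [e4] at h4
  have e5 : s / P.Δt = 1 / P.Δt * s := by ring
  have e6 : p / P.Δt = 1 / P.Δt * p := by ring
  have e7 : ∀ x, P.η * (1 / P.ε * x) = P.η / P.ε * x := fun x => by ring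
  simp only [phaseDensity, alpha, mul_add P.η, e5, e6, e7]
  -- The α-terms match exactly: s/2 + (p/2 - 1), multiplied by s - p, equals ((1 - s)² - (1 -
  -- p)²)/2. The time-step term `h5` is spare.
  nlinarith

/-! ### Integrated energy inequality for one phase step -/

theorem Lagr_eq {P : Params} {D : Set (Sp d)} {φ : Sp d → ℝ} {u : Sp d → Sp d} (lam : ℝ) :
    Lagr P D φ u lam = (∫ x in D, 1 / 2 * gradDot D u u x)
      + (∫ x in D, 1 / 2 * alpha P (φ x) * ‖u x‖ ^ 2)
      + P.η * (∫ x in D, (P.ε / 2 * ‖weakGrad D φ x‖ ^ 2 + 1 / P.ε * F (φ x)))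
      + lam * Jv P D φ := rfl

/-- The phase fields to which the scheme is applied: `H¹` functions with values in `[0, 1]`. -/
structure IsPhaseField (D : Set (Sp d)) (φ : Sp d → ℝ) : Prop where
  memH1 : MemH1 D φ
  range : ∀ᵐ x ∂(volume.restrict D), φ x ∈ Icc (0 : ℝ) 1

theorem IsPhaseField.integrable_alpha {P : Params} {D : Set (Sp d)} {φ : Sp d → ℝ}
    {u : Sp d → Sp d} (h : IsPhaseField D φ) (hu : MemLp u 2 (volume.restrict D)) :
    IntegrableOn (fun x => 1 / 2 * alpha P (φ x) * ‖u x‖ ^ 2) D volume :=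
  integrable_comp_mul (q := fun s => 1 / 2 * alpha P s) h.memH1.1.aestronglyMeasurable h.range
    (continuous_const.mul (continuous_alpha P)) (hu.integrable_norm_pow two_ne_zero)

theorem IsPhaseField.integrable_energy {P : Params} {D : Set (Sp d)} (hD : IsOpen D)
    (hfin : volume D ≠ ⊤) {φ : Sp d → ℝ} (h : IsPhaseField D φ) :
    IntegrableOn (fun x => P.ε / 2 * ‖weakGrad D φ x‖ ^ 2 + 1 / P.ε * F (φ x)) D volume := by
  refine (((h.memH1.memLp_weakGrad hD).integrable_norm_pow two_ne_zero).const_mul _).add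
    (Integrable.const_mul ?_ _)
  simpa using integrable_comp_mul h.memH1.1.aestronglyMeasurable h.range continuous_F
    (integrableOn_const (C := (1 : ℝ)) hfin)

/-- The function v is kept separate from φ because after the step the multiplier term is still
integrated against the untruncated field. -/
theorem IsPhaseField.integral_phaseDensity {P : Params} {D : Set (Sp d)} (hD : IsOpen D)
    (hfin : volume D ≠ ⊤) {φ v : Sp d → ℝ} {u : Sp d → Sp d} (h : IsPhaseField D φ)
    (hu : MemLp u 2 (volume.restrict D)) (hv : IntegrableOn v D volume) (lam : ℝ) :
    IntegrableOn (fun x => phaseDensity P (‖u x‖ ^ 2) lam (φ x) (‖weakGrad D φ x‖ ^ 2) (v x)) D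
        volume ∧
      ∫ x in D, phaseDensity P (‖u x‖ ^ 2) lam (φ x) (‖weakGrad D φ x‖ ^ 2) (v x)
        = (∫ x in D, 1 / 2 * alpha P (φ x) * ‖u x‖ ^ 2)
          + P.η * (∫ x in D, (P.ε / 2 * ‖weakGrad D φ x‖ ^ 2 + 1 / P.ε * F (φ x)))
          + lam * ∫ x in D, v x := by
  have i1 := h.integrable_alpha (P := P) hu
  have i2 := (h.integrable_energy (P := P) hD hfin).const_mul P.η
  have i3 := hv.const_mul lam
  have i12 : IntegrableOn (fun x => 1 / 2 * alpha P (φ x) * ‖u x‖ ^ 2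
      + P.η * (P.ε / 2 * ‖weakGrad D φ x‖ ^ 2 + 1 / P.ε * F (φ x))) D volume := i1.add i2
  refine ⟨i12.add i3, ?_⟩
  simp only [phaseDensity]
  rw [integral_add i12 i3, integral_add i1 i2, integral_const_mul, integral_const_mul]

theorem IsPhaseField.of_cutoff {D : Set (Sp d)} (hD : IsOpen D) (hfin : volume D ≠ ⊤)
    {φs φ : Sp d → ℝ} (hs : MemH1 D φs)
    (hcut : ∀ᵐ x ∂(volume.restrict D), φ x = cutoff (φs x)) : IsPhaseField D φ := by
  refine ⟨(hs.of_cutoff hD hfin hcut).1, ?_⟩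
  filter_upwards [hcut] with x hx
  rw [hx]
  exact cutoff_mem_Icc _

/-- A weight times a function that is square integrable with respect to it. -/
theorem integrable_weight_mul {α : Type*} [MeasurableSpace α] {μ : Measure α} {U a b : α → ℝ}
    (hUm : AEStronglyMeasurable U μ) (ha : AEStronglyMeasurable a μ)
    (hb : AEStronglyMeasurable b μ) (hU : ∀ x, 0 ≤ U x)
    (hUa : Integrable (fun x => U x * a x ^ 2) μ) (hUb : Integrable (fun x => U x * b x ^ 2) μ) :
    Integrable (fun x => U x * (a x * b x)) μ := by
  refine (hUa.add hUb).mono' (hUm.mul (ha.mul hb)) (Eventually.of_forall fun x => ?_)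
  rw [norm_mul, Real.norm_of_nonneg (hU x), Pi.add_apply, ← mul_add]
  refine mul_le_mul_of_nonneg_left ?_ (hU x)
  rw [Real.norm_eq_abs, abs_le]
  constructor <;>
    nlinarith [sq_nonneg (a x + b x), sq_nonneg (a x - b x), sq_nonneg (a x), sq_nonneg (b x)]

/-- One inner iteration does not increase the Lagrangian. -/
theorem IsPhaseStep.Lagr_le {P : Params} {D : Set (Sp d)} (hD : IsOpen D) (hfin : volume D ≠ ⊤)
    (hα : 0 ≤ P.α₀) (hε : 0 < P.ε) (hη : 0 < P.η) (hΔt : 0 < P.Δt)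
    (hS : P.η / (4 * P.ε) ≤ P.S) (hβ₀ : 0 ≤ P.β₀) {u : Sp d → Sp d} {lam : ℝ}
    {φ φs φ' : Sp d → ℝ} (hu : MemLp u 2 (volume.restrict D)) (hφ : IsPhaseField D φ)
    (h : IsPhaseStep P D u lam φ φs)
    (hcut : ∀ᵐ x ∂(volume.restrict D), φ' x = cutoff (φs x))
    (hvar : Jv P D φs < Jv P D φ' → Jv P D φ' ≠ 0)
    (hfix : lam < 0 → Jv P D φ' ≤ Jv P D φs →
      lam * (∫ x in D, (φ' x - φs x)) ≤ P.β₀ * Jv P D φ' ^ 2) :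
    Lagr P D φ' u (lamUpdate P D lam φs φ') ≤ Lagr P D φ u lam := by
  have : IsFiniteMeasure (volume.restrict D) := ⟨by simpa using hfin.lt_top⟩
  have hφ' := IsPhaseField.of_cutoff hD hfin h.memH1 hcut
  have hle := (h.memH1.of_cutoff hD hfin hcut).2
  have hsi : IntegrableOn φs D volume := h.memH1.1.integrable one_le_two
  have hφi : IntegrableOn φ D volume := hφ.memH1.1.integrable one_le_two
  have hφ'i : IntegrableOn φ' D volume := hφ'.memH1.1.integrable one_le_two
  have hlam := lamUpdate_mul_Jv_le hsi hφ'i hβ₀ hvar hfix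
  have hφm := hφ.memH1.1.aestronglyMeasurable
  have hsm := h.memH1.1.aestronglyMeasurable
  have hψ : MemH1 D (fun x => φs x - φ x) := h.memH1.sub hD hφ.memH1
  have hψi : IntegrableOn (fun x => φs x - φ x) D volume := hsi.sub hφi
  have hψm := hψ.1.aestronglyMeasurable
  have hU : IntegrableOn (fun x => ‖u x‖ ^ 2) D volume := hu.integrable_norm_pow two_ne_zero
  have hUm := hU.aestronglyMeasurable
  have hU0 : ∀ x, 0 ≤ ‖u x‖ ^ 2 := fun x => sq_nonneg _
  have hUφ : IntegrableOn (fun x => ‖u x‖ ^ 2 * φ x ^ 2) D volume :=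
    (integrable_comp_mul hφm hφ.range (continuous_pow 2) hU).congr
      (Eventually.of_forall fun x => mul_comm _ _)
  have hU1 : IntegrableOn (fun x => ‖u x‖ ^ 2 * (1 : ℝ) ^ 2) D volume := by simpa using hU
  have hUsφ := integrable_weight_mul hUm hsm hφm hU0 h.finite hUφ
  -- This puts φs - φ in the weighted test space: the square is expanded, φ being bounded and |u|²
  -- integrable.
  have hUψ : IntegrableOn (fun x => ‖u x‖ ^ 2 * (φs x - φ x) ^ 2) D volume := by
    refine ((h.finite.add hUφ).sub (hUsφ.const_mul 2)).congr (Eventually.of_forall fun x => ?_)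
    simp only [Pi.add_apply, Pi.sub_apply]
    ring
  have hUψ1 : IntegrableOn (fun x => ‖u x‖ ^ 2 * (φs x - φ x)) D volume := by
    simpa [IntegrableOn] using integrable_weight_mul hUm hψm aestronglyMeasurable_const hU0 hUψ hU1
  have hUsψ := integrable_weight_mul hUm hsm hψm hU0 h.finite hUψ
  have hweak := h.weak _ hψ hUψ
  have hsψ : IntegrableOn (fun x => φs x * (φs x - φ x)) D volume := h.memH1.1.integrable_mul hψ.1
  have hinner := integrable_inner_of_memLp (h.memH1.memLp_weakGrad hD) (hψ.memLp_weakGrad hD)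
  have iL : IntegrableOn (fun x => φs x / P.Δt * (φs x - φ x)
        + P.ε * P.η * inner ℝ (weakGrad D φs x) (weakGrad D (fun x => φs x - φ x) x)
        + P.α₀ * ‖u x‖ ^ 2 / 2 * φs x * (φs x - φ x)
        + P.S * φs x * (φs x - φ x)) D volume := by
    refine ((((hsψ.const_mul (1 / P.Δt)).add (hinner.const_mul (P.ε * P.η))).add
      (hUsψ.const_mul (P.α₀ / 2))).add (hsψ.const_mul P.S)).congr
      (Eventually.of_forall fun x => ?_)
    simp only [Pi.add_apply]
    ring
  have iR : IntegrableOn (fun x => (φ x / P.Δt - P.η / P.ε * f (φ x)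
        - P.α₀ * ‖u x‖ ^ 2 * (φ x / 2 - 1) - lam + P.S * φ x) * (φs x - φ x)) D volume := by
    have hf := continuous_f
    have r1 := integrable_comp_mul hφm hφ.range
      (q := fun s => s / P.Δt - P.η / P.ε * f s - lam + P.S * s) (by fun_prop) hψi
    have r2 := integrable_comp_mul hφm hφ.range
      (q := fun s => P.α₀ * (s / 2 - 1)) (by fun_prop) hUψ1
    refine (r1.sub r2).congr (Eventually.of_forall fun x => ?_)
    simp only [Pi.sub_apply]
    ring
  obtain ⟨k1, e1⟩ := hφ'.integral_phaseDensity (P := P) hD hfin hu hsi lam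
  obtain ⟨k2, e2⟩ := hφ.integral_phaseDensity (P := P) hD hfin hu hφi lam
  have hmono := integral_mono_ae k1 (k2.add (iL.sub iR)) (by
    filter_upwards [hφ.range, hcut, hle, h.memH1.weakGrad_sub hD hφ.memH1] with x h1 h2 h3 h4
    simp only [Pi.add_apply, Pi.sub_apply]
    rw [h2, h4]
    exact phaseDensity_cutoff_le hα hε hη hΔt hS h1 _ _ (hU0 x) h3)
  -- The weak equation cancels the residual. What is left compares the energies, with ∫ φs in the
  -- new multiplier term; `hlam` then passes to φ' and the updated multiplier.
  rw [integral_add' k2 (iL.sub iR), integral_sub' iL iR, hweak, sub_self, add_zero, e1, e2] at hmono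
  have hJ : ∀ v : Sp d → ℝ, lam * Jv P D v
      = lam * (∫ x in D, v x) - lam * (P.β * volume.real D) := fun v => by
    rw [Jv]; ring
  rw [Lagr_eq, Lagr_eq, hJ φ]
  rw [hJ φs] at hlam
  linarith

/-! ### Inner loop and outer step -/

/-- The inner loop keeps the phase fields in `H¹` with values in `[0, 1]` and does not increase
the Lagrangian. -/
theorem IsRun.inner_loop {P : Params} {D Γin Γwall : Set (Sp d)} {g : Sp d → Sp d} {N K : ℕ}
    {X : Iterates d} (hD : IsOpen D) (hfin : volume D ≠ ⊤)
    (hα : 0 ≤ P.α₀) (hε : 0 < P.ε) (hη : 0 < P.η) (hΔt : 0 < P.Δt)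
    (hS : P.η / (4 * P.ε) ≤ P.S) (hX : IsRun P D Γin Γwall g N K X)
    (hvar : VariableStepDefined P D N K X) (hfix : FixedStepProper P D N K X)
    {n : ℕ} (hn : n < N) (hφ : IsPhaseField D (X.phi n)) (k : ℕ) (hk : k ≤ K) :
    IsPhaseField D (X.phiIn (n + 1) k) ∧
      Lagr P D (X.phiIn (n + 1) k) (X.u (n + 1)) (X.lamIn (n + 1) k)
        ≤ Lagr P D (X.phi n) (X.u (n + 1)) (X.lam n) := by
  induction k with
  | zero =>
    rw [hX.start_phi n hn, hX.start_lam n hn]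
    exact ⟨hφ, le_rfl⟩
  | succ k ih =>
    obtain ⟨ih1, ih2⟩ := ih (Nat.le_of_succ_le hk)
    have hs := hX.phase n hn k hk
    have hc := hX.cut n hn k hk
    refine ⟨IsPhaseField.of_cutoff hD hfin hs.memH1 hc, le_trans ?_ ih2⟩
    rw [hX.multiplier n hn k hk]
    exact hs.Lagr_le hD hfin hα hε hη hΔt hS hfix.1 (hX.stokes n hn).velocity.memH1.memLp ih1 hc
      (hvar n hn k hk) (hfix.2 n hn k hk)

end PhaseStokes

open PhaseStokes in
theorem mainTheorem1 {d : ℕ} (hd : d = 2 ∨ d = 3)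
    (D Γin Γout : Set (Sp d)) (hD : IsLipschitzDomain D)
    (hΓin : Γin ⊆ frontier D) (hΓout : Γout ⊆ frontier D)
    (hΓinm : MeasurableSet Γin) (hΓoutm : MeasurableSet Γout) (hΓ : Disjoint Γin Γout)
    (g : Sp d → Sp d) (P : Params)
    (hα : 0 ≤ P.α₀) (hε : 0 < P.ε) (hη : 0 < P.η) (hβ : P.β ∈ Set.Icc (0 : ℝ) 1)
    (hΔt : 0 < P.Δt) (hS : P.η / (4 * P.ε) ≤ P.S)
    (N K : ℕ) (hK : 1 ≤ K) (X : Iterates d)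
    (hX : IsRun P D Γin (frontier D \ (Γin ∪ Γout)) g N K X)
    (hvar : VariableStepDefined P D N K X) (hfix : FixedStepProper P D N K X)
    (n : ℕ) (hn : n < N)
    (h₀ : n = 0 → MemH1 D (X.phi 0) ∧
      AdmissibleVelocity D Γin (frontier D \ (Γin ∪ Γout)) g (X.u 0)) :
    Lagr P D (X.phi (n + 1)) (X.u (n + 1)) (X.lam (n + 1)) ≤
      Lagr P D (X.phi n) (X.u n) (X.lam n) := by
  have hDo : IsOpen D := hD.1
  have hfin : volume D ≠ ⊤ := hD.2.2.1.measure_lt_top.ne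
  have hcur : IsPhaseField D (X.phi n) ∧
      AdmissibleVelocity D Γin (frontier D \ (Γin ∪ Γout)) g (X.u n) := by
    rcases n with _ | m
    · exact ⟨⟨(h₀ rfl).1, hX.init_range⟩, (h₀ rfl).2⟩
    · have hm : m < N := Nat.lt_of_succ_lt hn
      -- Since K ≥ 1, a later outer iterate is the truncation of an H¹ function, so no Sobolev
      -- regularity of φ⁰ is needed.
      obtain ⟨k, rfl⟩ : ∃ k, K = k + 1 := ⟨K - 1, (Nat.sub_add_cancel hK).symm⟩
      refine ⟨?_, (hX.stokes m hm).velocity⟩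
      rw [hX.finish_phi m hm]
      exact IsPhaseField.of_cutoff hDo hfin (hX.phase m hm k k.lt_succ_self).memH1
        (hX.cut m hm k k.lt_succ_self)
  obtain ⟨hφ, hu⟩ := hcur
  have hloop := (hX.inner_loop hDo hfin hα hε hη hΔt hS hvar hfix hn hφ K le_rfl).2
  rw [← hX.finish_phi n hn, ← hX.finish_lam n hn] at hloop
  refine hloop.trans ?_
  -- With φⁿ and λⁿ fixed, the velocity enters the Lagrangian only through `Jalpha`.
  have hJ := (hX.stokes n hn).Jalpha_le hDo hα hφ.memH1.1.aestronglyMeasurable hφ.range hu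
  unfold Lagr
  linarith
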